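/- Let $\mathbf{k}$ be a field of characteristic zero, let $v\in\mathbf{k}^{r\times n}$ be a matrix with columns $v_1,\dots,v_n\in\mathbf{k}^r$, and let $M(v)$ be the matroid on $[n]=\{1,\dots,n\}$ whose independent sets are the $I\subseteq[n]$ such that the columns $(v_i)_{i\in I}$ are linearly independent. Let $\mathfrak{S}(v)\subseteq(\mathbf{k}^r)^{\otimes n}$ be the cyclic $\mathfrak{S}_n$-module generated by $v_1\otimes\cdots\otimes v_n$, where $\mathfrak{S}_n$ permutes the tensor factors. For a matroid $M$ on $[n]$, a broken circuit is a circuit (minimal dependent set) with its smallest element removed, an nbc basis is a basis of $M$ containing no broken circuit, and the truncation of $M$ to rank $k\le\operatorname{rk}M$ is the matroid whose independent sets are the independent sets of $M$ of size at most $k$. Let $1\le k\le n$. If $k\le\operatorname{rk}M(v)$, then the multiplicity of the irreducible $\mathfrak{S}_n$-module indexed by the hook $(n-k+1,1^{k-1})$ in $\mathfrak{S}(v)$ is the number of nbc bases of the truncation of $M(v)$ to rank $k$; if $k>\operatorname{rk}M(v)$, then this multiplicity is $0$. (Here irreducibles are indexed so that $(n)$ is the trivial and $(1^n)$ the sign representation.)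 -/

import Mathlib

open scoped TensorProduct

namespace TensorModule

/-! ### Matroids -/

section Matroids

/-- The matroid `M(v)` on `[n]` of a matrix `v`: a set of column indices is independent when the
columns it indexes are linearly independent. -/
def vectorMatroid {𝕜 : Type*} [Field 𝕜] {r n : ℕ} (v : Matrix (Fin r) (Fin n) 𝕜) :
    Matroid (Fin n) :=
  (IndepMatroid.ofFinite (E := Set.univ) Set.finite_univ
    (Indep := fun I => LinearIndepOn 𝕜 (fun i => v.col i) I)
    (indep_empty := linearIndepOn_empty 𝕜 _)
    (indep_subset := fun _ _ hJ hIJ => hJ.mono hIJ)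
    (indep_aug := by
      intro I J hI hJ hlt
      by_contra! hcon
      have hspan : ∀ e ∈ J, v.col e ∈ Submodule.span 𝕜 ((fun i => v.col i) '' I) := by
        intro e he
        by_cases heI : e ∈ I
        · exact Submodule.subset_span ⟨e, heI, rfl⟩
        · by_contra hns
          exact hcon e he heI (hI.insert hns)
      have hle : Submodule.span 𝕜 ((fun i => v.col i) '' J)
          ≤ Submodule.span 𝕜 ((fun i => v.col i) '' I) := by
        rw [Submodule.span_le]
        rintro _ ⟨e, he, rfl⟩
        exact hspan e he
      have hfin := Submodule.finrank_mono hle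
      have hcard : ∀ S : Set (Fin n), LinearIndepOn 𝕜 (fun i => v.col i) S →
          Module.finrank 𝕜 (Submodule.span 𝕜 ((fun i => v.col i) '' S)) = S.ncard := by
        intro S hS
        classical
        have h := finrank_span_eq_card (R := 𝕜) (b := fun i : S => v.col i) hS
        rw [Set.image_eq_range]
        rw [h, ← Nat.card_eq_fintype_card, Nat.card_coe_set_eq]
      rw [hcard I hI, hcard J hJ] at hfin
      omega)
    (subset_ground := fun _ _ => Set.subset_univ _)).matroid

theorem vectorMatroid_indep_iff {𝕜 : Type*} [Field 𝕜] {r n : ℕ} (v : Matrix (Fin r) (Fin n) 𝕜)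
    (I : Set (Fin n)) :
    (vectorMatroid v).Indep I ↔ LinearIndepOn 𝕜 (fun i => v.col i) I := Iff.rfl

/-- The truncation of a matroid to rank `k` (for `k` at most the rank): its independent sets are
the independent sets of `M` with at most `k` elements. -/
def truncation {α : Type*} (M : Matroid α) (k : ℕ) : Matroid α :=
  (IndepMatroid.ofBddAugment (E := M.E)
    (Indep := fun I => M.Indep I ∧ I.encard ≤ k)
    (indep_empty := ⟨M.empty_indep, by simp⟩)
    (indep_subset := fun _ _ hJ hIJ => ⟨hJ.1.subset hIJ, (Set.encard_le_encard hIJ).trans hJ.2⟩)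
    (indep_aug := by
      intro I J hI hJ hlt
      obtain ⟨e, he, hins⟩ := hI.1.augment hJ.1 hlt
      refine ⟨e, he.1, he.2, hins, ?_⟩
      rw [Set.encard_insert_of_notMem he.2]
      exact (Order.add_one_le_of_lt hlt).trans hJ.2)
    (indep_bdd := ⟨k, fun _ hI => hI.2⟩)
    (subset_ground := fun _ hI => hI.1.subset_ground)).matroid

theorem truncation_indep_iff {α : Type*} (M : Matroid α) (k : ℕ) (I : Set α) :
    (truncation M k).Indep I ↔ M.Indep I ∧ I.encard ≤ k := Iff.rfl

variable {α : Type*} [LinearOrder α]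

/-- A broken circuit: a circuit with its smallest element removed. -/
def IsBrokenCircuit (M : Matroid α) (X : Set α) : Prop :=
  ∃ C e, M.IsCircuit C ∧ IsLeast C e ∧ X = C \ {e}

/-- An nbc set: a set of elements of `M` containing no broken circuit. -/
def IsNBC (M : Matroid α) (S : Set α) : Prop :=
  S ⊆ M.E ∧ ∀ X, IsBrokenCircuit M X → ¬ X ⊆ S

/-- The number of nbc bases. -/
noncomputable def numNBCBases (M : Matroid α) : ℕ :=
  {B : Set α | M.IsBase B ∧ IsNBC M B}.ncard

end Matroids

/-! ### Specht modules -/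

section Specht

variable {n : ℕ} {μ : YoungDiagram}

open scoped Classical in
/-- The Young symmetrizer `c_T = a_T b_T` of a bijective filling `T` of the diagram `μ` by `[n]`:
`a_T` is the sum of the permutations preserving the rows of `T`, and `b_T` is the signed sum of the
permutations preserving the columns. A cell `(i, j)` of `μ` lies in row `i` and column `j`. -/
noncomputable def youngSymmetrizer (𝕜 : Type*) [Field 𝕜] (T : Fin n ≃ μ.cells) :
    MonoidAlgebra 𝕜 (Equiv.Perm (Fin n)) :=
  (∑ p : Equiv.Perm (Fin n) with ∀ i, (T (p i)).1.1 = (T i).1.1, MonoidAlgebra.of 𝕜 _ p) *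
  (∑ q : Equiv.Perm (Fin n) with ∀ i, (T (q i)).1.2 = (T i).1.2,
    (Equiv.Perm.sign q : ℤ) • MonoidAlgebra.of 𝕜 _ q)

/-- The Specht module of shape `μ`, as the left ideal of the group algebra generated by the Young
symmetrizer. In characteristic zero these are the irreducible representations of the symmetric
group, `(n)` giving the trivial and `(1, …, 1)` the sign representation. -/
noncomputable def spechtModule (𝕜 : Type*) [Field 𝕜] (T : Fin n ≃ μ.cells) :
    Submodule (MonoidAlgebra 𝕜 (Equiv.Perm (Fin n))) (MonoidAlgebra 𝕜 (Equiv.Perm (Fin n))) :=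
  Submodule.span _ {youngSymmetrizer 𝕜 T}

/-- The multiplicity in `W` of the irreducible representation of shape `μ`, in characteristic zero:
the dimension of the space of `𝔖ₙ`-equivariant maps from the Specht module to `W`. (Specht modules
in characteristic zero are absolutely irreducible, so no division by the dimension of an
endomorphism algebra is needed.) -/
noncomputable def spechtMultiplicity (𝕜 : Type*) [Field 𝕜] (T : Fin n ≃ μ.cells)
    (W : Type*) [AddCommMonoid W] [Module 𝕜 W] [Module (MonoidAlgebra 𝕜 (Equiv.Perm (Fin n))) W]
    [IsScalarTower 𝕜 (MonoidAlgebra 𝕜 (Equiv.Perm (Fin n))) W] : ℕ :=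
  Module.finrank 𝕜 (spechtModule 𝕜 T →ₗ[MonoidAlgebra 𝕜 (Equiv.Perm (Fin n))] W)

/-- The Young diagram of the hook `(n - k + 1, 1, …, 1)` with `k - 1` trailing ones. -/
def hookShape (n k : ℕ) : YoungDiagram :=
  YoungDiagram.ofRowLens ((n - k + 1) :: List.replicate (k - 1) 1) (by
    rw [List.sortedGE_iff_pairwise, List.pairwise_cons]
    refine ⟨fun a ha => ?_, List.pairwise_replicate.2 (Or.inr le_rfl)⟩
    rw [List.eq_of_mem_replicate ha]
    omega)

theorem mem_hookShape {n k : ℕ} {c : ℕ × ℕ} :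
    c ∈ (hookShape n k).cells ↔
      (c.1 = 0 ∧ c.2 < n - k + 1) ∨ (0 < c.1 ∧ c.1 < k - 1 + 1 ∧ c.2 = 0) := by
  rw [YoungDiagram.mem_cells, hookShape, YoungDiagram.mem_ofRowLens]
  obtain ⟨i, j⟩ := c
  cases i with
  | zero => simp
  | succ i => simp

/-- The filling of the hook of length `k` placing `0, …, k - 1` down the first column and
`k, …, n - 1` along the rest of the first row. -/
noncomputable def hookFilling {n k : ℕ} (hk : 1 ≤ k) (hkn : k ≤ n) :
    Fin n ≃ (hookShape n k).cells :=
  Equiv.ofBijective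
    (fun i => ⟨if (i : ℕ) < k then ((i : ℕ), 0) else (0, (i : ℕ) - k + 1), by
      have := i.2
      rw [mem_hookShape]
      split_ifs <;> simp <;> omega⟩)
    (by
      constructor
      · intro i j hij
        have h := congrArg Subtype.val hij
        dsimp only at h
        ext
        split_ifs at h <;> simp only [Prod.mk.injEq] at h <;> omega
      · rintro ⟨⟨a, b⟩, hc⟩
        have hc' := mem_hookShape.1 hc
        dsimp only at hc'
        by_cases hb : b = 0
        · refine ⟨⟨a, by omega⟩, Subtype.ext ?_⟩
          have : a < k := by omega
          simp [this, hb]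
        · refine ⟨⟨k + b - 1, by omega⟩, Subtype.ext ?_⟩
          have h1 : ¬ (k + b - 1 < k) := by omega
          simp only [h1, if_false, Prod.mk.injEq]
          omega)

end Specht

/-! ### The cyclic module generated by a decomposable tensor -/

section Tensors

variable {𝕜 : Type*} [Field 𝕜] {r n : ℕ}

/-- The action of the symmetric group on `(𝕜ʳ)^{⊗ n}` by permuting tensor factors:
`σ • (w₁ ⊗ ⋯ ⊗ wₙ)` has `wᵢ` in position `σ i`. -/
noncomputable def permTensor (𝕜 : Type*) [Field 𝕜] (r n : ℕ) :
    Representation 𝕜 (Equiv.Perm (Fin n)) (⨂[𝕜] _ : Fin n, (Fin r → 𝕜)) where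
  toFun σ := (PiTensorProduct.reindex 𝕜 (fun _ : Fin n => (Fin r → 𝕜)) σ).toLinearMap
  map_one' := by
    refine PiTensorProduct.ext (MultilinearMap.ext fun w => ?_)
    exact PiTensorProduct.reindex_tprod _ _
  map_mul' σ τ := by
    refine PiTensorProduct.ext (MultilinearMap.ext fun w => ?_)
    have h : ∀ (ρ : Equiv.Perm (Fin n)) (u : Fin n → (Fin r → 𝕜)),
        PiTensorProduct.reindex 𝕜 (fun _ : Fin n => (Fin r → 𝕜)) ρ (PiTensorProduct.tprod 𝕜 u)
          = PiTensorProduct.tprod 𝕜 (fun i => u (ρ.symm i)) :=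
      fun ρ u => PiTensorProduct.reindex_tprod _ _
    refine (h (σ * τ) w).trans ?_
    refine Eq.trans ?_ (congrArg
      (PiTensorProduct.reindex 𝕜 (fun _ : Fin n => (Fin r → 𝕜)) σ) (h τ w)).symm
    exact (h σ fun i => w (τ.symm i)).symm

theorem permTensor_tprod (σ : Equiv.Perm (Fin n)) (w : Fin n → (Fin r → 𝕜)) :
    permTensor 𝕜 r n σ (PiTensorProduct.tprod 𝕜 w)
      = PiTensorProduct.tprod 𝕜 (fun i => w (σ.symm i)) :=
  PiTensorProduct.reindex_tprod _ _

/-- The cyclic `𝔖ₙ`-module generated by the tensor `v₁ ⊗ ⋯ ⊗ vₙ` of the columns of `v`. -/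
noncomputable def cyclicModule (v : Matrix (Fin r) (Fin n) 𝕜) :
    Submodule (MonoidAlgebra 𝕜 (Equiv.Perm (Fin n))) (permTensor 𝕜 r n).asModule :=
  Submodule.span _
    {(permTensor 𝕜 r n).asModuleEquiv.symm (PiTensorProduct.tprod 𝕜 fun i => v.col i)}

end Tensors

end TensorModule

/-!
The multiplicity of the hook is the dimension of `c • W`, where `c = a b` is the Young symmetrizer
of the hook of length `k` and `W` is the cyclic module (`finrank_hom_span_singleton`, from Maschke's
theorem). This space is spanned by the tensors `hookTensor k v σ = a b (σ • v₁ ⊗ ⋯ ⊗ vₙ)`. Up to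
sign, such a tensor depends only on the set `S` of the `k` vectors that fill the first column. It is
the image of `v_S ⊗ ∏_{i ∉ S} v_i` under the Koszul differential
`Λᵏ ⊗ Sym → Λᵏ⁻¹ ⊗ Sym`; dividing by `∏ v_i`, it becomes the contraction with the Euler vector field
of the logarithmic form `∧_{i ∈ S} dlog v_i`. It remains to see that the hook tensors of the nbc
bases of the truncated matroid form a basis of the span.

*Spanning.* The hook tensor of a dependent set vanishes, and every circuit `C` of the truncation
contained in a set `T` of `k + 1` vectors gives a relation, up to signs, `∑_{j ∈ C} [T \ j] = 0`
(`sum_swap_hookTensor_eq_zero`). For a circuit of `M(v)` this is the vanishing of a determinant,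
before the row symmetrization; for `C = T` it is the relation `d ∘ d = 0` of the Koszul complex.
A set containing a broken circuit `C \ c` can therefore be replaced by sets with a smaller sum of
elements (`hookTensor_mem_span_nbc`).

*Independence.* For an nbc basis `s 0 < ⋯ < s (k - 1)` take linear forms `q j` dual to it, with
`q 0` as generic as possible, and evaluate hook tensors along the curve `p = ∑ Xʲ qⱼ` in the row `0`
and at the forms `qⱼ` in the rows `j ≥ 1`. The value at `S` is a constant times
`∏_{i ∉ S} p(v_i)`, and the order `d i` of `p(v_i)` describes the flag of the spans of
`s m, …, s (k - 1)`. As `s m` is the smallest element of the `m`-th member of the flag, the nbc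
basis `s` is the only one with maximal `∑_{i ∈ S} d i` (`sum_lt_sum_of_isNBC`), so the lowest coefficient
of its value is a linear form that vanishes on the hook tensors of the others
(`exists_form_of_isNBC`).
-/

namespace TensorModule

/-! ### Groups of permutations and the two symmetrizers -/

section Symmetrizers

/-- The permutations of `Fin n` that fix every position `≥ m`. -/
def firstPerms (n m : ℕ) : Finset (Equiv.Perm (Fin n)) :=
  {q | ∀ i : Fin n, m ≤ i → q i = i}

theorem mem_firstPerms {n m : ℕ} {q : Equiv.Perm (Fin n)} :
    q ∈ firstPerms n m ↔ ∀ i : Fin n, m ≤ i → q i = i := by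
  simp [firstPerms]

theorem lt_of_mem_firstPerms {n m : ℕ} {q : Equiv.Perm (Fin n)} (hq : q ∈ firstPerms n m)
    {i : Fin n} (hi : (i : ℕ) < m) : (q i : ℕ) < m := by
  by_contra hlt
  rw [mem_firstPerms] at hq
  have := q.injective (hq (q i) (not_lt.1 hlt))
  omega

theorem mul_mem_firstPerms {n m : ℕ} {p q : Equiv.Perm (Fin n)} (hp : p ∈ firstPerms n m)
    (hq : q ∈ firstPerms n m) : p * q ∈ firstPerms n m := by
  rw [mem_firstPerms] at *
  intro i hi
  rw [Equiv.Perm.mul_apply, hq i hi, hp i hi]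

theorem inv_mem_firstPerms {n m : ℕ} {p : Equiv.Perm (Fin n)} (hp : p ∈ firstPerms n m) :
    p⁻¹ ∈ firstPerms n m := by
  rw [mem_firstPerms] at *
  intro i hi
  rw [Equiv.Perm.inv_eq_iff_eq, hp i hi]

/-- The row of position `i` in the filling `hookFilling` of the hook of length `k`. -/
def hookRow (k i : ℕ) : ℕ := if i < k then i else 0

/-- The permutations of `Fin n` that preserve the rows of the hook of length `k`. -/
def hookRowPerms (n k : ℕ) : Finset (Equiv.Perm (Fin n)) :=
  {p | ∀ i : Fin n, hookRow k (p i) = hookRow k i}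

theorem mem_hookRowPerms {n k : ℕ} {p : Equiv.Perm (Fin n)} :
    p ∈ hookRowPerms n k ↔ ∀ i : Fin n, hookRow k (p i) = hookRow k i := by
  simp [hookRowPerms]

theorem mul_mem_hookRowPerms {n k : ℕ} {p q : Equiv.Perm (Fin n)} (hp : p ∈ hookRowPerms n k)
    (hq : q ∈ hookRowPerms n k) : p * q ∈ hookRowPerms n k := by
  rw [mem_hookRowPerms] at *
  intro i
  rw [Equiv.Perm.mul_apply, hp, hq]

theorem inv_mem_hookRowPerms {n k : ℕ} {p : Equiv.Perm (Fin n)} (hp : p ∈ hookRowPerms n k) :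
    p⁻¹ ∈ hookRowPerms n k := by
  rw [mem_hookRowPerms] at *
  intro i
  rw [← hp (p⁻¹ i)]
  simp

variable {𝕜 : Type*} [Field 𝕜] {r n : ℕ}

/-- The signed sum of the permutations of the first `m` tensor factors. For `m = k` this is the
action of the column part of the Young symmetrizer of the hook of length `k`. -/
noncomputable def antisymmetrizer (𝕜 : Type*) [Field 𝕜] (r n m : ℕ) :
    Module.End 𝕜 (⨂[𝕜] _ : Fin n, (Fin r → 𝕜)) :=
  ∑ q ∈ firstPerms n m, ((Equiv.Perm.sign q : ℤ) : 𝕜) • permTensor 𝕜 r n q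

/-- The action of the row part of the Young symmetrizer of the hook of length `k`. -/
noncomputable def rowSymmetrizer (𝕜 : Type*) [Field 𝕜] (r n k : ℕ) :
    Module.End 𝕜 (⨂[𝕜] _ : Fin n, (Fin r → 𝕜)) :=
  ∑ p ∈ hookRowPerms n k, permTensor 𝕜 r n p

theorem antisymmetrizer_mul_permTensor {m : ℕ} {q : Equiv.Perm (Fin n)}
    (hq : q ∈ firstPerms n m) :
    antisymmetrizer 𝕜 r n m * permTensor 𝕜 r n q =
      ((Equiv.Perm.sign q : ℤ) : 𝕜) • antisymmetrizer 𝕜 r n m := by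
  rw [antisymmetrizer, Finset.sum_mul, Finset.smul_sum]
  refine Finset.sum_bij' (fun p _ => p * q) (fun p _ => p * q⁻¹)
    (fun p hp => mul_mem_firstPerms hp hq)
    (fun p hp => mul_mem_firstPerms hp (inv_mem_firstPerms hq)) (by simp) (by simp) ?_
  intro p _
  rw [smul_mul_assoc, ← map_mul, smul_smul, Equiv.Perm.sign_mul,
    mul_comm ((Equiv.Perm.sign q : ℤ) : 𝕜), ← Int.cast_mul, ← Units.val_mul, mul_assoc,
    Int.units_mul_self, mul_one]

theorem permTensor_mul_antisymmetrizer {m : ℕ} {q : Equiv.Perm (Fin n)} (hq : q ∈ firstPerms n m) :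
    permTensor 𝕜 r n q * antisymmetrizer 𝕜 r n m =
      ((Equiv.Perm.sign q : ℤ) : 𝕜) • antisymmetrizer 𝕜 r n m := by
  rw [antisymmetrizer, Finset.mul_sum, Finset.smul_sum]
  refine Finset.sum_bij' (fun p _ => q * p) (fun p _ => q⁻¹ * p)
    (fun p hp => mul_mem_firstPerms hq hp)
    (fun p hp => mul_mem_firstPerms (inv_mem_firstPerms hq) hp) (by simp) (by simp) ?_
  intro p _
  rw [mul_smul_comm, ← map_mul, smul_smul, Equiv.Perm.sign_mul, ← Int.cast_mul,
    ← Units.val_mul, ← mul_assoc, Int.units_mul_self, one_mul]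

theorem rowSymmetrizer_mul_permTensor {k : ℕ} {q : Equiv.Perm (Fin n)} (hq : q ∈ hookRowPerms n k) :
    rowSymmetrizer 𝕜 r n k * permTensor 𝕜 r n q = rowSymmetrizer 𝕜 r n k := by
  rw [rowSymmetrizer, Finset.sum_mul]
  refine Finset.sum_bij' (fun p _ => p * q) (fun p _ => p * q⁻¹)
    (fun p hp => mul_mem_hookRowPerms hp hq)
    (fun p hp => mul_mem_hookRowPerms hp (inv_mem_hookRowPerms hq)) (by simp) (by simp) ?_
  intro p _
  rw [map_mul]

/-- Antisymmetrizing the first `k + 1` factors and then symmetrizing the first row gives zero: the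
positions `0` and `k` are both in the first row. This is the relation `d ∘ d = 0` of the Koszul
complex. -/
theorem rowSymmetrizer_mul_antisymmetrizer_succ [CharZero 𝕜] {k : ℕ} (hk : 1 ≤ k) (hkn : k < n) :
    rowSymmetrizer 𝕜 r n k * antisymmetrizer 𝕜 r n (k + 1) = 0 := by
  set s : Equiv.Perm (Fin n) := Equiv.swap ⟨0, by omega⟩ ⟨k, hkn⟩ with hs
  have hne : (⟨0, by omega⟩ : Fin n) ≠ ⟨k, hkn⟩ := by
    simp only [ne_eq, Fin.mk.injEq]; omega
  have hsR : s ∈ hookRowPerms n k := by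
    rw [mem_hookRowPerms]
    intro i
    rw [hs, Equiv.swap_apply_def]
    split_ifs with h1 h2
    · subst h1; simp [hookRow]
    · subst h2; simp [hookRow]
    · rfl
  have hsC : s ∈ firstPerms n (k + 1) := by
    rw [mem_firstPerms]
    intro i hi
    apply Equiv.swap_apply_of_ne_of_ne <;> rw [ne_eq, Fin.ext_iff] <;> dsimp only <;> omega
  set X := rowSymmetrizer 𝕜 r n k * antisymmetrizer 𝕜 r n (k + 1) with hX
  have h : X = (-1 : 𝕜) • X := by
    conv_lhs => rw [hX, ← rowSymmetrizer_mul_permTensor hsR, mul_assoc,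
      permTensor_mul_antisymmetrizer hsC, hs, Equiv.Perm.sign_swap hne, mul_smul_comm, ← hX]
    simp
  have h2 : (2 : 𝕜) • X = 0 := by
    calc (2 : 𝕜) • X = X + X := two_smul 𝕜 X
      _ = (1 : 𝕜) • X + (-1 : 𝕜) • X := by rw [← h, one_smul]
      _ = 0 := by rw [← add_smul, add_neg_cancel, zero_smul]
  exact (smul_eq_zero.1 h2).resolve_left two_ne_zero

/-- The image under the Young symmetrizer of the hook of length `k` of the tensor with `w i` in
position `σ i`. -/
noncomputable def hookTensor (k : ℕ) (w : Fin n → (Fin r → 𝕜)) (σ : Equiv.Perm (Fin n)) :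
    ⨂[𝕜] _ : Fin n, (Fin r → 𝕜) :=
  rowSymmetrizer 𝕜 r n k (antisymmetrizer 𝕜 r n k
    (permTensor 𝕜 r n σ (PiTensorProduct.tprod 𝕜 w)))

theorem hookTensor_mul_of_mem_firstPerms {k : ℕ} (w : Fin n → (Fin r → 𝕜))
    {q : Equiv.Perm (Fin n)} (hq : q ∈ firstPerms n k) (σ : Equiv.Perm (Fin n)) :
    hookTensor k w (q * σ) = ((Equiv.Perm.sign q : ℤ) : 𝕜) • hookTensor k w σ := by
  rw [hookTensor, map_mul, Module.End.mul_apply, ← Module.End.mul_apply (antisymmetrizer 𝕜 r n k),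
    antisymmetrizer_mul_permTensor hq, LinearMap.smul_apply, map_smul, hookTensor]

theorem hookTensor_mul_of_fixes {k : ℕ} (w : Fin n → (Fin r → 𝕜))
    {h : Equiv.Perm (Fin n)} (hh : ∀ i : Fin n, (i : ℕ) < k → h i = i) (σ : Equiv.Perm (Fin n)) :
    hookTensor k w (h * σ) = hookTensor k w σ := by
  have hge : ∀ i : Fin n, k ≤ i → k ≤ h i := by
    intro i hi
    by_contra hlt
    have := h.injective (hh (h i) (not_le.1 hlt))
    omega
  have hR : h ∈ hookRowPerms n k := by
    rw [mem_hookRowPerms]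
    intro i
    by_cases hi : (i : ℕ) < k
    · rw [hh i hi]
    · simp only [hookRow, if_neg hi, if_neg (not_lt.2 (hge i (not_lt.1 hi)))]
  have hcomm : antisymmetrizer 𝕜 r n k * permTensor 𝕜 r n h =
      permTensor 𝕜 r n h * antisymmetrizer 𝕜 r n k := by
    rw [antisymmetrizer, Finset.sum_mul, Finset.mul_sum]
    refine Finset.sum_congr rfl fun q hq => ?_
    rw [smul_mul_assoc, mul_smul_comm, ← map_mul, ← map_mul]
    congr 2
    ext i : 1
    rw [Equiv.Perm.mul_apply, Equiv.Perm.mul_apply]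
    by_cases hi : (i : ℕ) < k
    · rw [hh i hi, hh _ (lt_of_mem_firstPerms hq hi)]
    · rw [mem_firstPerms.1 hq i (not_lt.1 hi), mem_firstPerms.1 hq _ (hge i (not_lt.1 hi))]
  rw [hookTensor, map_mul, Module.End.mul_apply, ← Module.End.mul_apply (antisymmetrizer 𝕜 r n k),
    hcomm, Module.End.mul_apply, ← Module.End.mul_apply (rowSymmetrizer 𝕜 r n k),
    rowSymmetrizer_mul_permTensor hR, hookTensor]

/-- Up to sign, `hookTensor k w σ` depends only on which `k` vectors fill the first column. -/
theorem hookTensor_mem_span_of_forall_lt_iff {k : ℕ} (w : Fin n → (Fin r → 𝕜))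
    {σ τ : Equiv.Perm (Fin n)} (hστ : ∀ i, (σ i : ℕ) < k ↔ (τ i : ℕ) < k) :
    hookTensor k w σ ∈ Submodule.span 𝕜 {hookTensor k w τ} := by
  set g : Equiv.Perm (Fin n) := σ * τ⁻¹ with hg
  have hgk : ∀ i : Fin n, (g i : ℕ) < k ↔ (i : ℕ) < k := by
    intro i
    rw [hg, Equiv.Perm.mul_apply, hστ]
    simp
  set q : Equiv.Perm (Fin n) := Equiv.Perm.ofSubtype
    (g.subtypePerm (p := fun i : Fin n => (i : ℕ) < k) hgk) with hq
  have hqk : q ∈ firstPerms n k := by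
    rw [mem_firstPerms]
    intro i hi
    exact Equiv.Perm.ofSubtype_apply_of_not_mem _ (not_lt.2 hi)
  have hh : ∀ i : Fin n, (i : ℕ) < k → (q⁻¹ * g) i = i := by
    intro i hi
    rw [Equiv.Perm.mul_apply, Equiv.Perm.inv_eq_iff_eq, hq]
    exact (Equiv.Perm.ofSubtype_apply_of_mem
      (g.subtypePerm (p := fun i : Fin n => (i : ℕ) < k) hgk) hi).symm
  have hσ : σ = q * ((q⁻¹ * g) * τ) := by rw [hg]; group
  rw [hσ, hookTensor_mul_of_mem_firstPerms w hqk, hookTensor_mul_of_fixes w hh]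
  exact Submodule.smul_mem _ _ (Submodule.mem_span_singleton_self _)

end Symmetrizers

/-! ### Evaluating tensors at linear maps to an algebra -/

section Pairing

variable {𝕜 : Type*} [Field 𝕜] {r n : ℕ} {R : Type*} [CommRing R] [Algebra 𝕜 R]

/-- The linear map `w₁ ⊗ ⋯ ⊗ wₙ ↦ u₁(w₁) ⋯ uₙ(wₙ)` to a commutative algebra `R`. -/
noncomputable def pairing (u : Fin n → ((Fin r → 𝕜) →ₗ[𝕜] R)) :
    (⨂[𝕜] _ : Fin n, (Fin r → 𝕜)) →ₗ[𝕜] R :=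
  PiTensorProduct.lift ((MultilinearMap.mkPiAlgebra 𝕜 (Fin n) R).compLinearMap u)

theorem pairing_tprod (u : Fin n → ((Fin r → 𝕜) →ₗ[𝕜] R)) (w : Fin n → (Fin r → 𝕜)) :
    pairing u (PiTensorProduct.tprod 𝕜 w) = ∏ i, u i (w i) := by
  simp [pairing]

theorem pairing_permTensor (u : Fin n → ((Fin r → 𝕜) →ₗ[𝕜] R)) (σ : Equiv.Perm (Fin n))
    (y : ⨂[𝕜] _ : Fin n, (Fin r → 𝕜)) :
    pairing u (permTensor 𝕜 r n σ y) = pairing (fun i => u (σ i)) y := by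
  suffices h : pairing u ∘ₗ permTensor 𝕜 r n σ = pairing (fun i => u (σ i)) from
    LinearMap.congr_fun h y
  refine PiTensorProduct.ext (MultilinearMap.ext fun w => ?_)
  simp only [LinearMap.compMultilinearMap_apply, LinearMap.comp_apply, permTensor_tprod,
    pairing_tprod]
  exact (Fintype.prod_equiv σ _ _ fun i => by simp).symm

/-- Tensors are separated by products of linear forms. -/
theorem eq_zero_of_forall_pairing_eq_zero (y : ⨂[𝕜] _ : Fin n, (Fin r → 𝕜))
    (h : ∀ u : Fin n → ((Fin r → 𝕜) →ₗ[𝕜] 𝕜), pairing u y = 0) : y = 0 := by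
  let b := Basis.piTensorProduct (R := 𝕜) (fun _ : Fin n => Pi.basisFun 𝕜 (Fin r))
  refine b.ext_elem fun p => ?_
  rw [map_zero, Finsupp.zero_apply, ← h fun i => LinearMap.proj (p i)]
  suffices h : b.coord p = pairing (fun i => LinearMap.proj (p i)) from LinearMap.congr_fun h y
  refine PiTensorProduct.ext (MultilinearMap.ext fun w => ?_)
  simp [b, pairing_tprod, Basis.piTensorProduct_repr_tprod_apply]

/-- A signed sum over the permutations of the first `m` indices is a determinant. -/
theorem sum_firstPerms_eq_det (m : ℕ) (N : Matrix (Fin n) (Fin n) R) :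
    ∑ q ∈ firstPerms n m, ((Equiv.Perm.sign q : ℤ) : R) * ∏ i, N (q i) i =
      (∏ i ∈ Finset.univ.filter (fun i : Fin n => ¬ (i : ℕ) < m), N i i) *
        (Matrix.of fun i j : {i : Fin n // (i : ℕ) < m} => N i j).det := by
  rw [Matrix.det_apply', Finset.mul_sum]
  symm
  refine Finset.sum_bij (fun p _ => Equiv.Perm.ofSubtype p) ?_ ?_ ?_ ?_
  · intro p _
    rw [mem_firstPerms]
    exact fun i hi => Equiv.Perm.ofSubtype_apply_of_not_mem _ (not_lt.2 hi)
  · exact fun p _ q _ h => Equiv.Perm.ofSubtype_injective h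
  · intro q hq
    have hlt : ∀ i : Fin n, (q i : ℕ) < m ↔ (i : ℕ) < m := by
      refine fun i => ⟨fun h => ?_, lt_of_mem_firstPerms hq⟩
      by_contra hi
      rw [mem_firstPerms.1 hq i (not_lt.1 hi)] at h
      exact hi h
    refine ⟨q.subtypePerm hlt, Finset.mem_univ _, Equiv.Perm.ofSubtype_subtypePerm hlt ?_⟩
    intro i hi
    by_contra hlt
    exact hi (mem_firstPerms.1 hq i (not_lt.1 hlt))
  · intro p _
    rw [Equiv.Perm.sign_ofSubtype, mul_left_comm,
      ← Finset.prod_filter_mul_prod_filter_not Finset.univ (fun i : Fin n => (i : ℕ) < m),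
      mul_comm (∏ i ∈ _, _) (∏ i ∈ Finset.univ.filter (fun i : Fin n => ¬ (i : ℕ) < m), _)]
    congr 2
    · refine Finset.prod_congr rfl fun i hi => ?_
      rw [Equiv.Perm.ofSubtype_apply_of_not_mem p (Finset.mem_filter.1 hi).2]
    · rw [Finset.prod_subtype (p := fun i : Fin n => (i : ℕ) < m) _ (by simp)]
      refine Finset.prod_congr rfl fun i _ => ?_
      rw [Equiv.Perm.ofSubtype_apply_coe]
      rfl

theorem pairing_antisymmetrizer (u : Fin n → ((Fin r → 𝕜) →ₗ[𝕜] R)) (m : ℕ)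
    (σ : Equiv.Perm (Fin n)) (w : Fin n → (Fin r → 𝕜)) :
    pairing u (antisymmetrizer 𝕜 r n m (permTensor 𝕜 r n σ (PiTensorProduct.tprod 𝕜 w))) =
      (∏ i ∈ Finset.univ.filter (fun i : Fin n => ¬ (i : ℕ) < m), u i (w (σ.symm i))) *
        (Matrix.of fun i j : {i : Fin n // (i : ℕ) < m} => u i (w (σ.symm j))).det := by
  have h := sum_firstPerms_eq_det m (Matrix.of fun i j : Fin n => u i (w (σ.symm j)))
  refine Eq.trans ?_ h
  rw [antisymmetrizer, LinearMap.sum_apply, map_sum]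
  refine Finset.sum_congr rfl fun q _ => ?_
  rw [LinearMap.smul_apply, map_smul, pairing_permTensor, permTensor_tprod, pairing_tprod,
    Algebra.smul_def, map_intCast]
  rfl

/-- A family of linear maps that is constant on the rows of the hook does not distinguish a tensor
from its row permutations. -/
theorem pairing_rowSymmetrizer (k : ℕ) (U : ℕ → ((Fin r → 𝕜) →ₗ[𝕜] R))
    (y : ⨂[𝕜] _ : Fin n, (Fin r → 𝕜)) :
    pairing (fun i : Fin n => U (hookRow k i)) (rowSymmetrizer 𝕜 r n k y) =
      (hookRowPerms n k).card • pairing (fun i : Fin n => U (hookRow k i)) y := by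
  rw [rowSymmetrizer, LinearMap.sum_apply, map_sum, ← Finset.sum_const]
  refine Finset.sum_congr rfl fun p hp => ?_
  rw [pairing_permTensor]
  simp only [mem_hookRowPerms.1 hp]

end Pairing

/-! ### Linear relations among the hook tensors -/

section Relations

variable {𝕜 : Type*} [Field 𝕜] {r n : ℕ}

/-- The vectors filling the first column of the hook of length `k`. -/
def firstColumn {n : ℕ} (k : ℕ) (σ : Equiv.Perm (Fin n)) : Set (Fin n) := {i | (σ i : ℕ) < k}

theorem mem_firstColumn {k : ℕ} {σ : Equiv.Perm (Fin n)} {i : Fin n} :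
    i ∈ firstColumn k σ ↔ (σ i : ℕ) < k := Iff.rfl

theorem encard_firstColumn {k : ℕ} (hkn : k ≤ n) (σ : Equiv.Perm (Fin n)) :
    (firstColumn k σ).encard = k := by
  have h : firstColumn k σ = Set.range fun j : Fin k => σ.symm (Fin.castLE hkn j) := by
    ext i
    rw [mem_firstColumn, Set.mem_range]
    refine ⟨fun hi => ⟨⟨σ i, hi⟩, ?_⟩, ?_⟩
    · rw [Equiv.symm_apply_eq]; rfl
    · rintro ⟨j, rfl⟩
      simp
  have hinj : Function.Injective fun j : Fin k => σ.symm (Fin.castLE hkn j) :=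
    σ.symm.injective.comp (Fin.castLE_injective hkn)
  rw [h, ← Set.image_univ, hinj.encard_image, Set.encard_univ]
  simp

theorem exists_firstColumn_eq {k : ℕ} (hkn : k ≤ n) {S : Set (Fin n)} (hS : S.encard = k) :
    ∃ σ : Equiv.Perm (Fin n), firstColumn k σ = S := by
  classical
  have hcard : Fintype.card {i // i ∈ S} = Fintype.card {i : Fin n // (i : ℕ) < k} := by
    rw [← Nat.card_eq_fintype_card, ← Nat.card_eq_fintype_card]
    change S.ncard = (firstColumn k (1 : Equiv.Perm (Fin n))).ncard
    rw [Set.ncard, Set.ncard, hS, encard_firstColumn hkn]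
  let e : {i // i ∈ S} ≃ {i : Fin n // (i : ℕ) < k} := Fintype.equivOfCardEq hcard
  refine ⟨e.extendSubtype, ?_⟩
  ext i
  rw [mem_firstColumn]
  refine ⟨fun hi => ?_, fun hi => e.extendSubtype_mem i hi⟩
  by_contra hiS
  exact e.extendSubtype_not_mem i hiS hi

theorem exists_relation_of_not_linearIndepOn {w : Fin n → (Fin r → 𝕜)} {s : Set (Fin n)}
    (h : ¬ LinearIndepOn 𝕜 w s) :
    ∃ a : Fin n → 𝕜, a ≠ 0 ∧ (∀ i, a i ≠ 0 → i ∈ s) ∧ ∑ i, a i • w i = 0 := by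
  rw [linearIndepOn_iff] at h
  push Not at h
  obtain ⟨l, hl, hl0, hne⟩ := h
  refine ⟨l, fun h0 => hne (DFunLike.coe_injective h0), fun i hi => ?_, ?_⟩
  · exact (Finsupp.mem_supported 𝕜 l).1 hl (Finsupp.mem_support_iff.2 hi)
  · rw [Finsupp.linearCombination_apply, Finsupp.sum_fintype _ _ (by simp)] at hl0
    exact hl0

/-- A linear relation of vectors makes the columns of their matrix of values dependent, also after
the entries in columns outside the support of the relation are scaled arbitrarily. -/
theorem det_eq_zero_of_relation {ι : Type*} [Fintype ι] [DecidableEq ι]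
    (u : ι → ((Fin r → 𝕜) →ₗ[𝕜] 𝕜)) (z : ι → (Fin r → 𝕜)) (e : ι → ι → 𝕜)
    (a : ι → 𝕜) (ha : a ≠ 0) (hz : ∑ j, a j • z j = 0) (he : ∀ i j, a j ≠ 0 → e i j = 1) :
    (Matrix.of fun i j => u i (z j) * e i j).det = 0 := by
  rw [← Matrix.exists_mulVec_eq_zero_iff]
  refine ⟨a, ha, ?_⟩
  ext i
  rw [Pi.zero_apply, ← map_zero (u i), ← hz, map_sum, Matrix.mulVec, dotProduct]
  refine Finset.sum_congr rfl fun j _ => ?_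
  by_cases hj : a j = 0
  · simp [hj]
  · simp [he i j hj, mul_comm]

/-- A linear relation supported in the first `m` positions, indexed by these positions. -/
theorem relation_on_positions {w : Fin n → (Fin r → 𝕜)} {m : ℕ} {σ : Equiv.Perm (Fin n)}
    {a : Fin n → 𝕜} (ha : a ≠ 0) (has : ∀ i, a i ≠ 0 → (σ i : ℕ) < m)
    (hrel : ∑ i, a i • w i = 0) :
    (fun j : {i : Fin n // (i : ℕ) < m} => a (σ.symm j)) ≠ 0 ∧
      ∑ j : {i : Fin n // (i : ℕ) < m}, a (σ.symm j) • w (σ.symm j) = 0 := by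
  constructor
  · intro h0
    refine ha (funext fun i => ?_)
    by_contra hi
    have := congrFun h0 ⟨σ i, has i hi⟩
    simp only [Equiv.symm_apply_apply, Pi.zero_apply] at this
    exact hi this
  · rw [← hrel, ← Equiv.sum_comp σ.symm (fun i => a i • w i),
      ← Finset.sum_filter_add_sum_filter_not Finset.univ (fun i : Fin n => (i : ℕ) < m),
      ← Finset.sum_subtype_eq_sum_filter (p := fun i : Fin n => (i : ℕ) < m),
      Finset.subtype_univ]
    rw [Finset.sum_eq_zero (s := Finset.filter _ _), add_zero]
    intro i hi
    by_contra hne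
    have h1 : a (σ.symm i) ≠ 0 := fun h => hne (by rw [h, zero_smul])
    have h2 := has _ h1
    rw [Equiv.apply_symm_apply] at h2
    exact (Finset.mem_filter.1 hi).2 h2

theorem antisymmetrizer_eq_zero {w : Fin n → (Fin r → 𝕜)} {m : ℕ} {σ : Equiv.Perm (Fin n)}
    (h : ¬ LinearIndepOn 𝕜 w (firstColumn m σ)) :
    antisymmetrizer 𝕜 r n m (permTensor 𝕜 r n σ (PiTensorProduct.tprod 𝕜 w)) = 0 := by
  obtain ⟨a, ha, has, hrel⟩ := exists_relation_of_not_linearIndepOn h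
  obtain ⟨h1, h2⟩ := relation_on_positions ha has hrel
  refine eq_zero_of_forall_pairing_eq_zero _ fun u => ?_
  rw [pairing_antisymmetrizer]
  have := det_eq_zero_of_relation (fun i : {i : Fin n // (i : ℕ) < m} => u i)
    (fun j => w (σ.symm j)) (fun _ _ => 1) _ h1 h2 (fun _ _ _ => rfl)
  simp only [mul_one] at this
  rw [this, mul_zero]

/-- The decomposition of the permutations of the first `k + 1` positions into cosets of the
permutations of the first `k` positions, indexed by the preimage of the position `k`. -/
theorem sum_firstPerms_swap {X : Type*} [AddCommMonoid X] {k : ℕ} (K : Fin n) (hK : (K : ℕ) = k)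
    (D : Finset (Fin n)) (hD : ∀ l ∈ D, (l : ℕ) ≤ k) (f : Equiv.Perm (Fin n) → X) :
    ∑ l ∈ D, ∑ q ∈ firstPerms n k, f (q * Equiv.swap l K) =
      ∑ p ∈ (firstPerms n (k + 1)).filter (fun p => p.symm K ∈ D), f p := by
  have hsw : ∀ l : Fin n, (l : ℕ) ≤ k → Equiv.swap l K ∈ firstPerms n (k + 1) := by
    intro l hl
    rw [mem_firstPerms]
    intro i hi
    apply Equiv.swap_apply_of_ne_of_ne <;> rw [ne_eq, Fin.ext_iff] <;> omega
  have hmono : ∀ q ∈ firstPerms n k, q ∈ firstPerms n (k + 1) := by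
    intro q hq
    rw [mem_firstPerms] at *
    exact fun i hi => hq i (by omega)
  rw [← Finset.sum_product']
  refine Finset.sum_bij' (fun x _ => x.2 * Equiv.swap x.1 K)
    (fun p _ => (p.symm K, p * Equiv.swap (p.symm K) K)) ?_ ?_ ?_ ?_ (fun _ _ => rfl)
  · rintro ⟨l, q⟩ h
    rw [Finset.mem_product] at h
    have hqK : q.symm K = K := by
      rw [Equiv.symm_apply_eq, mem_firstPerms.1 h.2 K hK.ge]
    rw [Finset.mem_filter]
    refine ⟨mul_mem_firstPerms (hmono _ h.2) (hsw _ (hD _ h.1)), ?_⟩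
    simpa [Equiv.Perm.mul_def, hqK] using h.1
  · intro p hp
    rw [Finset.mem_filter] at hp
    rw [Finset.mem_product]
    refine ⟨hp.2, ?_⟩
    rw [mem_firstPerms]
    intro i hi
    rw [Equiv.Perm.mul_apply]
    rcases eq_or_ne i K with rfl | hne
    · rw [Equiv.swap_apply_right, Equiv.apply_symm_apply]
    · have h1 : k + 1 ≤ i := by
        rw [ne_eq, Fin.ext_iff] at hne; omega
      have h2 := mem_firstPerms.1 hp.1 i h1
      rw [Equiv.swap_apply_of_ne_of_ne _ hne, h2]
      rw [ne_eq, Equiv.eq_symm_apply, h2]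
      exact hne
  · rintro ⟨l, q⟩ h
    rw [Finset.mem_product] at h
    have hqK : q.symm K = K := by
      rw [Equiv.symm_apply_eq, mem_firstPerms.1 h.2 K hK.ge]
    have h1 : (q * Equiv.swap l K).symm K = l := by
      simp [Equiv.Perm.mul_def, hqK]
    simp [h1, mul_assoc]
  · intro p _
    simp [mul_assoc]

theorem sum_swap_antisymmetrizer {k : ℕ} (K : Fin n) (hK : (K : ℕ) = k)
    (D : Finset (Fin n)) (hD : ∀ l ∈ D, (l : ℕ) ≤ k) (y : ⨂[𝕜] _ : Fin n, (Fin r → 𝕜)) :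
    ∑ l ∈ D, ((Equiv.Perm.sign (Equiv.swap l K) : ℤ) : 𝕜) •
        antisymmetrizer 𝕜 r n k (permTensor 𝕜 r n (Equiv.swap l K) y) =
      ∑ p ∈ (firstPerms n (k + 1)).filter (fun p => p.symm K ∈ D),
        ((Equiv.Perm.sign p : ℤ) : 𝕜) • permTensor 𝕜 r n p y := by
  rw [← sum_firstPerms_swap K hK D hD]
  refine Finset.sum_congr rfl fun l _ => ?_
  rw [antisymmetrizer, LinearMap.sum_apply, Finset.smul_sum]
  refine Finset.sum_congr rfl fun q _ => ?_
  rw [LinearMap.smul_apply, smul_smul, map_mul (permTensor 𝕜 r n), Module.End.mul_apply,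
    Equiv.Perm.sign_mul, Units.val_mul, Int.cast_mul,
    mul_comm ((Equiv.Perm.sign q : ℤ) : 𝕜)]

/-- The relation given by a dependent set of vectors in the first `k + 1` positions: its vectors
are moved in turn to the position `k`. Evaluated at linear forms, it says that a determinant
vanishes whose rows satisfy the linear relation of the vectors. -/
theorem sum_swap_antisymmetrizer_eq_zero {k : ℕ} (K : Fin n) (hK : (K : ℕ) = k)
    {w : Fin n → (Fin r → 𝕜)} {σ : Equiv.Perm (Fin n)} {D : Finset (Fin n)}
    (hD : ∀ l ∈ D, (l : ℕ) ≤ k) (hdep : ¬ LinearIndepOn 𝕜 w {i | σ i ∈ D}) :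
    ∑ l ∈ D, ((Equiv.Perm.sign (Equiv.swap l K) : ℤ) : 𝕜) •
        antisymmetrizer 𝕜 r n k (permTensor 𝕜 r n (Equiv.swap l K)
          (permTensor 𝕜 r n σ (PiTensorProduct.tprod 𝕜 w))) = 0 := by
  classical
  rw [sum_swap_antisymmetrizer K hK D hD]
  refine eq_zero_of_forall_pairing_eq_zero _ fun u => ?_
  -- The last row of the matrix, belonging to position `k`, is restricted to the columns in `D`.
  let e : Fin n → Fin n → 𝕜 := fun m l => if m = K ∧ l ∉ D then 0 else 1
  have hprod : ∀ p : Equiv.Perm (Fin n), ∏ i, e (p i) i = if p.symm K ∈ D then 1 else 0 := by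
    intro p
    split_ifs with hp
    · refine Finset.prod_eq_one fun i _ => if_neg ?_
      rintro ⟨rfl, hi⟩
      exact hi (by simpa using hp)
    · exact Finset.prod_eq_zero (Finset.mem_univ (p.symm K)) (by simp [e, hp])
  have hdet := sum_firstPerms_eq_det (k + 1)
    (Matrix.of fun i j : Fin n => u i (w (σ.symm j)) * e i j)
  obtain ⟨a, ha, has, hrel⟩ := exists_relation_of_not_linearIndepOn hdep
  obtain ⟨h1, h2⟩ := relation_on_positions (m := k + 1) ha
    (fun i hi => Nat.lt_succ_of_le (hD _ (has i hi))) hrel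
  have hzero := det_eq_zero_of_relation (fun i : {i : Fin n // (i : ℕ) < k + 1} => u i)
    (fun j => w (σ.symm j)) (fun i j => e i j) _ h1 h2 (by
      intro i j hj
      have := has _ hj
      rw [Set.mem_ofPred_eq, Equiv.apply_symm_apply] at this
      exact if_neg fun h => h.2 this)
  simp only [Matrix.of_apply] at hdet
  rw [hzero, mul_zero] at hdet
  rw [← hdet, map_sum, Finset.sum_filter]
  refine Finset.sum_congr rfl fun p _ => ?_
  rw [map_smul, pairing_permTensor, permTensor_tprod, pairing_tprod, Finset.prod_mul_distrib,
    hprod, smul_eq_mul]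
  split_ifs <;> simp

/-- Both kinds of circuits of the truncated matroid give relations between hook tensors: the
dependent sets of vectors, and the sets of `k + 1` vectors. -/
theorem sum_swap_hookTensor_eq_zero [CharZero 𝕜] {k : ℕ} (hk : 1 ≤ k) (K : Fin n)
    (hK : (K : ℕ) = k)
    {w : Fin n → (Fin r → 𝕜)} {σ : Equiv.Perm (Fin n)} {D : Finset (Fin n)}
    (hD : ∀ l ∈ D, (l : ℕ) ≤ k)
    (h : ¬ LinearIndepOn 𝕜 w {i | σ i ∈ D} ∨ ∀ l : Fin n, (l : ℕ) ≤ k → l ∈ D) :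
    ∑ l ∈ D, ((Equiv.Perm.sign (Equiv.swap l K) : ℤ) : 𝕜) •
      hookTensor k w (Equiv.swap l K * σ) = 0 := by
  have hsum : ∑ l ∈ D, ((Equiv.Perm.sign (Equiv.swap l K) : ℤ) : 𝕜) •
      hookTensor k w (Equiv.swap l K * σ) = rowSymmetrizer 𝕜 r n k
        (∑ l ∈ D, ((Equiv.Perm.sign (Equiv.swap l K) : ℤ) : 𝕜) •
          antisymmetrizer 𝕜 r n k (permTensor 𝕜 r n (Equiv.swap l K)
            (permTensor 𝕜 r n σ (PiTensorProduct.tprod 𝕜 w)))) := by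
    rw [map_sum]
    refine Finset.sum_congr rfl fun l _ => ?_
    rw [map_smul, hookTensor, map_mul, Module.End.mul_apply]
  rw [hsum]
  rcases h with h | h
  · rw [sum_swap_antisymmetrizer_eq_zero K hK hD h, map_zero]
  · rw [sum_swap_antisymmetrizer K hK D hD, Finset.filter_true_of_mem]
    · have := rowSymmetrizer_mul_antisymmetrizer_succ (𝕜 := 𝕜) (r := r) hk (hK ▸ K.2)
      have h2 := LinearMap.congr_fun this
        (permTensor 𝕜 r n σ (PiTensorProduct.tprod 𝕜 w))
      simpa [antisymmetrizer] using h2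
    · intro p hp
      refine h _ (Nat.le_of_lt_succ ?_)
      exact lt_of_mem_firstPerms (inv_mem_firstPerms hp) (by omega)

end Relations

/-! ### Straightening: the hook tensors of nbc bases span -/

section Straightening

variable {𝕜 : Type*} [Field 𝕜] {r n : ℕ}

theorem hookTensor_eq_zero {v : Matrix (Fin r) (Fin n) 𝕜} {k : ℕ} {σ : Equiv.Perm (Fin n)}
    (h : ¬ (vectorMatroid v).Indep (firstColumn k σ)) :
    hookTensor k (fun i => v.col i) σ = 0 := by
  rw [vectorMatroid_indep_iff] at h
  rw [hookTensor, antisymmetrizer_eq_zero h, map_zero]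

/-- A circuit `C` of the truncated matroid all of whose elements but `c` fill positions in the first
column allows to exchange `c` for one of them. -/
theorem hookTensor_mem_span_exchange [CharZero 𝕜] {v : Matrix (Fin r) (Fin n) 𝕜} {k : ℕ}
    (hk : 1 ≤ k) {σ : Equiv.Perm (Fin n)} {C : Set (Fin n)}
    (hC : ¬ (truncation (vectorMatroid v) k).Indep C) {c : Fin n} (hc : c ∈ C)
    (hσc : c ∉ firstColumn k σ) (hCσ : C \ {c} ⊆ firstColumn k σ) :
    hookTensor k (fun i => v.col i) σ ∈ Submodule.span 𝕜
      {x | ∃ τ : Equiv.Perm (Fin n), ∃ j ∈ C \ {c},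
        firstColumn k τ = insert c (firstColumn k σ \ {j}) ∧
          x = hookTensor k (fun i => v.col i) τ} := by
  classical
  rw [mem_firstColumn] at hσc
  have hkn : k < n := by have := (σ c).2; omega
  let K : Fin n := ⟨k, hkn⟩
  have hKk : (K : ℕ) = k := rfl
  -- `c` may be assumed to be in position `k`.
  let σ' : Equiv.Perm (Fin n) := Equiv.swap (σ c) K * σ
  have hσ'c : σ' c = K := by simp [σ']
  have hσ' : hookTensor k (fun i => v.col i) σ' = hookTensor k (fun i => v.col i) σ := by
    refine hookTensor_mul_of_fixes _ (fun i hi => ?_) σ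
    apply Equiv.swap_apply_of_ne_of_ne <;> rw [ne_eq, Fin.ext_iff] <;> omega
  have hcol : ∀ i, (σ' i : ℕ) < k ↔ (σ i : ℕ) < k := by
    intro i
    change ((Equiv.swap (σ c) K (σ i) : Fin n) : ℕ) < k ↔ _
    rw [Equiv.swap_apply_def]
    split_ifs with h1 h2
    · rw [h1]; omega
    · rw [h2]; omega
    · rfl
  rw [← hσ']
  let D : Finset (Fin n) := Finset.univ.filter fun l => σ'.symm l ∈ C
  have hmemD : ∀ i, σ' i ∈ D ↔ i ∈ C := fun i => by simp [D]
  have hlt : ∀ i ∈ C, i ≠ c → (σ' i : ℕ) < k := fun i hi hne => (hcol i).2 (hCσ ⟨hi, hne⟩)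
  have hD : ∀ l ∈ D, (l : ℕ) ≤ k := by
    intro l hl
    obtain ⟨i, rfl⟩ := σ'.surjective l
    rcases eq_or_ne i c with rfl | hne
    · rw [hσ'c]
    · exact (hlt i ((hmemD i).1 hl) hne).le
  have hrel := sum_swap_hookTensor_eq_zero (w := fun i => v.col i) (σ := σ') hk K rfl hD (by
    rw [truncation_indep_iff, not_and_or, vectorMatroid_indep_iff] at hC
    simp only [hmemD]
    refine hC.imp id fun hcard l hl => ?_
    have hsub : C ⊆ firstColumn (k + 1) σ' := by
      intro i hi
      exact Nat.lt_succ_of_le (hD _ ((hmemD i).2 hi))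
    have heq : C = firstColumn (k + 1) σ' := by
      refine (Set.toFinite _).eq_of_subset_of_encard_le hsub ?_
      rw [encard_firstColumn hkn]
      exact_mod_cast Order.add_one_le_of_lt (not_le.1 hcard)
    rw [← Equiv.apply_symm_apply σ' l, hmemD, heq, mem_firstColumn, Equiv.apply_symm_apply]
    omega)
  have hKD : K ∈ D := by rw [← hσ'c, hmemD]; exact hc
  rw [← Finset.add_sum_erase _ _ hKD, Equiv.swap_self, Equiv.Perm.sign_refl] at hrel
  have hone : (Equiv.refl (Fin n)) * σ' = σ' := rfl
  rw [hone, Units.val_one, Int.cast_one, one_smul] at hrel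
  rw [eq_neg_of_add_eq_zero_left hrel]
  refine Submodule.neg_mem _ (Submodule.sum_mem _ fun l hl => Submodule.smul_mem _ _ ?_)
  rw [Finset.mem_erase] at hl
  obtain ⟨j, rfl⟩ := σ'.surjective l
  have hjc : j ≠ c := by rintro rfl; exact hl.1 hσ'c
  refine Submodule.subset_span ⟨_, j, ⟨(hmemD j).1 hl.2, hjc⟩, ?_, rfl⟩
  ext i
  have hjlt := hlt j ((hmemD j).1 hl.2) hjc
  rw [Set.mem_insert_iff, Set.mem_sdiff, Set.mem_singleton_iff, mem_firstColumn, mem_firstColumn,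
    ← hcol, Equiv.Perm.mul_apply, Equiv.swap_apply_def]
  split_ifs with h1 h2
  · have := σ'.injective h1
    subst this
    simp [K, hjc]
  · have : i = c := σ'.injective (h2.trans hσ'c.symm)
    simp [this, hjlt]
  · have h3 : i ≠ j := fun h => h1 (by rw [h])
    have h4 : i ≠ c := fun h => h2 (by rw [h, hσ'c])
    simp [h3, h4]

theorem isBase_truncation {α : Type*} [Finite α] {M : Matroid α} {k : ℕ} {S : Set α}
    (hS : M.Indep S) (hcard : S.encard = k) : (truncation M k).IsBase S := by
  refine Matroid.Indep.isBase_of_maximal ⟨hS, hcard.le⟩ fun J hJ hSJ => ?_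
  exact (Set.toFinite _).eq_of_subset_of_encard_le hSJ (hJ.2.trans hcard.ge)

/-- Hook tensors are straightened to nbc bases: a broken circuit `C \ {c}` in the first column is
removed by exchanging one of its elements for the smaller element `c`. -/
theorem hookTensor_mem_span_nbc [CharZero 𝕜] (v : Matrix (Fin r) (Fin n) 𝕜) {k : ℕ}
    (hk : 1 ≤ k) (hkn : k ≤ n) (σ : Equiv.Perm (Fin n)) :
    hookTensor k (fun i => v.col i) σ ∈ Submodule.span 𝕜
      {x | ∃ τ : Equiv.Perm (Fin n),
        (truncation (vectorMatroid v) k).IsBase (firstColumn k τ) ∧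
        IsNBC (truncation (vectorMatroid v) k) (firstColumn k τ) ∧
          x = hookTensor k (fun i => v.col i) τ} := by
  classical
  induction hN : ∑ i : Fin n with i ∈ firstColumn k σ, (i : ℕ) using Nat.strong_induction_on
    generalizing σ with
  | _ N ih =>
    by_cases hind : (vectorMatroid v).Indep (firstColumn k σ)
    swap
    · rw [hookTensor_eq_zero hind]
      exact Submodule.zero_mem _
    have hbase := isBase_truncation hind (encard_firstColumn hkn σ)
    by_cases hnbc : IsNBC (truncation (vectorMatroid v) k) (firstColumn k σ)
    · exact Submodule.subset_span ⟨σ, hbase, hnbc, rfl⟩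
    have : ∃ X, IsBrokenCircuit (truncation (vectorMatroid v) k) X ∧ X ⊆ firstColumn k σ := by
      by_contra! hcon
      exact hnbc ⟨hbase.subset_ground, hcon⟩
    obtain ⟨_, ⟨C, c, hC, hc, rfl⟩, hsub⟩ := this
    have hcσ : c ∉ firstColumn k σ := by
      intro hcσ
      refine hC.not_indep (hbase.indep.subset fun i hi => ?_)
      by_cases hic : i = c
      · rwa [hic]
      · exact hsub ⟨hi, hic⟩
    refine Submodule.span_le.2 ?_ (hookTensor_mem_span_exchange hk hC.not_indep hc.1 hcσ hsub)
    rintro _ ⟨τ, j, hj, hτ, rfl⟩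
    refine ih _ ?_ τ rfl
    have hjσ := hsub hj
    have hcj : c < j := lt_of_le_of_ne (hc.2 hj.1) (Ne.symm hj.2)
    have h1 : Finset.univ.filter (fun i => i ∈ firstColumn k τ) =
        insert c ((Finset.univ.filter (fun i => i ∈ firstColumn k σ)).erase j) := by
      ext i
      simp [hτ, and_comm]
    have h2 := Finset.add_sum_erase (Finset.univ.filter (fun i => i ∈ firstColumn k σ))
      (fun i : Fin n => (i : ℕ)) (a := j) (by simpa using hjσ)
    rw [h1, Finset.sum_insert (by simp [hcσ]), ← hN, ← h2]
    have : (c : ℕ) < j := hcj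
    omega

end Straightening

/-! ### Combinatorics of nbc bases along a flag -/

section NBC

/-- An nbc set cannot contain a set `A` that becomes dependent on adding an element smaller than
all of `A`. -/
theorem IsNBC.indep_insert {α : Type*} [LinearOrder α] {M : Matroid α} {B A : Set α}
    (hB : M.Indep B) (hnbc : IsNBC M B) (hAB : A ⊆ B) {i : α} (hiE : i ∈ M.E)
    (hi : ∀ a ∈ A, i < a) : M.Indep (insert i A) := by
  by_contra hdep
  have hdep' : M.Dep (insert i A) :=
    ⟨hdep, Set.insert_subset hiE (hAB.trans hB.subset_ground)⟩
  obtain ⟨C, hCsub, hC⟩ := hdep'.exists_isCircuit_subset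
  have hiC : i ∈ C := by
    by_contra hiC
    exact hC.not_indep (hB.subset (((Set.subset_insert_iff_of_notMem hiC).1 hCsub).trans hAB))
  refine hnbc.2 (C \ {i}) ⟨C, i, hC, ⟨hiC, fun a ha => ?_⟩, rfl⟩ ?_
  · rcases hCsub ha with rfl | haA
    · exact le_rfl
    · exact (hi a haA).le
  · rintro a ⟨ha, hai⟩
    exact hAB ((hCsub ha).resolve_left hai)

theorem card_filter_le_fin (k m : ℕ) :
    (Finset.univ.filter fun l : Fin k => m ≤ (l : ℕ)).card = k - m := by
  rw [← Nat.card_Ico, ← Finset.card_map Fin.valEmbedding]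
  congr 1
  ext x
  simp only [Finset.mem_map, Finset.mem_filter, Finset.mem_univ, true_and, Fin.valEmbedding_apply,
    Finset.mem_Ico]
  exact ⟨fun ⟨l, hl, h⟩ => h ▸ ⟨hl, l.2⟩, fun h => ⟨⟨x, h.2⟩, h.1, rfl⟩⟩

theorem sum_eq_sum_card_filter {α : Type*} (A : Finset α) {d : α → ℕ} {k : ℕ}
    (hd : ∀ i, d i < k) :
    ∑ i ∈ A, d i = ∑ m ∈ Finset.range k, (A.filter fun i => m + 1 ≤ d i).card := by
  simp_rw [Finset.card_filter]
  rw [Finset.sum_comm]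
  refine Finset.sum_congr rfl fun i _ => ?_
  rw [← Finset.card_filter]
  have : (Finset.range k).filter (fun m => m + 1 ≤ d i) = Finset.range (d i) := by
    ext m
    simp only [Finset.mem_filter, Finset.mem_range]
    have := hd i
    omega
  rw [this, Finset.card_range]

/-- Let `d` describe a flag of sets `G_m = {i | m ≤ d i}` of rank at most `k - m`, and let
`s 0 < ⋯ < s (k - 1)` be an nbc basis adapted to the flag. Then it is the only nbc basis with the
maximal value of `∑ d`: the element `s m` is the minimum of `G_m`, and a basis meeting `G_m` in
`k - m` elements but not containing `s m` contains a broken circuit. -/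
theorem sum_lt_sum_of_isNBC {n k : ℕ} {M : Matroid (Fin n)} (hME : M.E = Set.univ)
    {d : Fin n → ℕ} (hd : ∀ i, d i < k)
    (hrank : ∀ (m : ℕ) (A : Finset (Fin n)), M.Indep (A : Set (Fin n)) → (∀ i ∈ A, m ≤ d i) →
      A.card ≤ k - m)
    {s : Fin k → Fin n} (hs : StrictMono s) (hds : ∀ l, d (s l) = l)
    (hind : M.Indep (Set.range s)) (hnbc : IsNBC M (Set.range s))
    {B : Finset (Fin n)} (hB : M.Indep (B : Set (Fin n))) (hBnbc : IsNBC M (B : Set (Fin n)))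
    (hBcard : B.card = k) (hne : (B : Set (Fin n)) ≠ Set.range s) :
    ∑ i ∈ B, d i < ∑ l : Fin k, (l : ℕ) := by
  classical
  -- Each `s l` is the minimum of `{i | l ≤ d i}`.
  have hmin : ∀ (l : Fin k) (i : Fin n), (l : ℕ) ≤ d i → s l ≤ i := by
    intro l i hli
    by_contra! hlt
    let A : Finset (Fin n) := (Finset.univ.filter fun l' : Fin k => (l : ℕ) ≤ l').image s
    have hA : ∀ a ∈ A, i < a ∧ (l : ℕ) ≤ d a ∧ a ∈ Set.range s := by
      intro a ha
      obtain ⟨l', hl', rfl⟩ := Finset.mem_image.1 ha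
      have hle : l ≤ l' := (Finset.mem_filter.1 hl').2
      exact ⟨hlt.trans_le (hs.monotone hle), by rw [hds]; exact hle, l', rfl⟩
    have hindA := hnbc.indep_insert hind (A := (A : Set (Fin n))) (fun a ha => (hA a ha).2.2)
      (i := i) (by rw [hME]; trivial) (fun a ha => (hA a ha).1)
    rw [← Finset.coe_insert] at hindA
    have hcard := hrank l _ hindA (by
      intro a ha
      rcases Finset.mem_insert.1 ha with rfl | ha
      · exact hli
      · exact (hA a ha).2.1)
    rw [Finset.card_insert_of_notMem (fun h => lt_irrefl _ (hA i h).1),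
      Finset.card_image_of_injective _ hs.injective, card_filter_le_fin] at hcard
    omega
  have hle : ∀ m, (B.filter fun i => m ≤ d i).card ≤ k - m := by
    intro m
    refine hrank m _ (hB.subset ?_) (fun i hi => (Finset.mem_filter.1 hi).2)
    exact_mod_cast Finset.filter_subset _ _
  obtain ⟨l, hl⟩ : ∃ l, s l ∉ B := by
    by_contra! hcon
    refine hne (Set.Finite.eq_of_subset_of_encard_le (Set.toFinite _) ?_ ?_).symm
    · rintro _ ⟨l, rfl⟩
      exact hcon l
    · rw [← Set.image_univ, hs.injective.encard_image, Set.encard_univ,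
        Set.encard_coe_eq_coe_finsetCard, hBcard]
      simp
  have hlt : (B.filter fun i => (l : ℕ) ≤ d i).card < k - l := by
    refine lt_of_le_of_ne (hle l) fun heq => ?_
    have hindA := hBnbc.indep_insert hB (A := (B.filter fun i => (l : ℕ) ≤ d i : Finset (Fin n)))
      (by exact_mod_cast Finset.filter_subset _ _) (i := s l) (by rw [hME]; trivial) (by
        intro a ha
        have ha' := Finset.mem_filter.1 (Finset.mem_coe.1 ha)
        exact lt_of_le_of_ne (hmin l a ha'.2) (by rintro rfl; exact hl ha'.1))
    rw [← Finset.coe_insert] at hindA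
    have hcard := hrank l _ hindA (by
      intro a ha
      rcases Finset.mem_insert.1 ha with rfl | ha
      · exact (hds l).ge
      · exact (Finset.mem_filter.1 ha).2)
    rw [Finset.card_insert_of_notMem (fun h => hl (Finset.mem_filter.1 h).1), heq] at hcard
    omega
  have hl0 : (l : ℕ) ≠ 0 := by
    intro h0
    rw [h0] at hlt
    simp [hBcard] at hlt
  rw [sum_eq_sum_card_filter B hd, Fin.sum_univ_eq_sum_range (fun i => i),
    ← Finset.sum_range_reflect (fun i => i)]
  refine Finset.sum_lt_sum (fun m _ => ?_) ⟨l - 1, ?_, ?_⟩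
  · have := hle (m + 1)
    omega
  · rw [Finset.mem_range]
    have := l.2
    omega
  · rw [Nat.sub_add_cancel (Nat.pos_of_ne_zero hl0)]
    omega

end NBC

/-! ### Degeneration along the flag of an nbc basis -/

section Degeneration

variable {𝕜 : Type*} [Field 𝕜] {r n : ℕ}

/-- Linear forms `q` dual to a linearly independent family `w ∘ s`, up to scalars, the first of
them being generic: it vanishes only on those `w i` where it has to, which are those in the span of
the `w (s l)` with `l ≥ 1`. Hence any `w i` killed by the first `m ≥ 1` forms lies in the span of
the `w (s l)` with `l ≥ m`. -/
theorem exists_dual_flag [CharZero 𝕜] {k : ℕ} (w : Fin n → (Fin r → 𝕜)) (s : Fin k → Fin n)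
    (hs : LinearIndependent 𝕜 fun l => w (s l)) :
    ∃ q : Fin k → ((Fin r → 𝕜) →ₗ[𝕜] 𝕜), (∀ l m, q m (w (s l)) ≠ 0 ↔ l = m) ∧
      ∀ (m : ℕ) (i : Fin n), 1 ≤ m → m ≤ k → (∀ j : Fin k, (j : ℕ) < m → q j (w i) = 0) →
        w i ∈ Submodule.span 𝕜 ((fun l => w (s l)) '' {l : Fin k | m ≤ (l : ℕ)}) := by
  classical
  obtain ⟨g, hg⟩ := LinearMap.exists_leftInverse_of_injective
    (Fintype.linearCombination 𝕜 fun l => w (s l))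
    (LinearMap.ker_eq_bot.2 (linearIndependent_iff_injective_fintypeLinearCombination.1 hs))
  have hgs : ∀ l, g (w (s l)) = Pi.single l 1 := by
    intro l
    have := LinearMap.congr_fun hg (Pi.single l 1)
    simpa using this
  let F : Submodule 𝕜 (Fin r → 𝕜) := Submodule.span 𝕜 ((fun l => w (s l)) '' {l | (l : ℕ) ≠ 0})
  obtain ⟨f, hf⟩ := Module.exists_dual_forall_apply_ne_zero (K := 𝕜)
    (fun i : {i : Fin n // w i ∉ F} => F.mkQ (w i))
    (fun i => by simpa [Submodule.Quotient.mk_eq_zero] using i.2)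
  have hfF : ∀ x ∈ F, f (F.mkQ x) = 0 := by
    intro x hx
    rw [(Submodule.Quotient.mk_eq_zero F).2 hx |> (fun h => (h : F.mkQ x = 0)), map_zero]
  let q : Fin k → ((Fin r → 𝕜) →ₗ[𝕜] 𝕜) := fun m =>
    if (m : ℕ) = 0 then f ∘ₗ F.mkQ else LinearMap.proj m ∘ₗ g
  have hq : ∀ l m, q m (w (s l)) ≠ 0 ↔ l = m := by
    intro l m
    by_cases hm : (m : ℕ) = 0
    · simp only [q, if_pos hm, LinearMap.comp_apply]
      by_cases hl : (l : ℕ) = 0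
      · have hlm : l = m := Fin.ext (hl.trans hm.symm)
        have hnot : w (s l) ∉ F := hs.notMem_span_image (by simpa using hl)
        exact iff_of_true (hf ⟨s l, hnot⟩) hlm
      · have hlm : l ≠ m := fun h => hl (h ▸ hm)
        exact iff_of_false (not_not.2 (hfF _ (Submodule.subset_span ⟨l, hl, rfl⟩))) hlm
    · simp [q, hm, hgs, Pi.single_apply, eq_comm]
  refine ⟨q, hq, fun m i hm hmk hi => ?_⟩
  have hiF : w i ∈ F := by
    by_contra hnot
    have h0 := hi ⟨0, by omega⟩ (by exact hm)
    simp only [q, if_true] at h0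
    exact hf ⟨i, hnot⟩ h0
  have hiR : w i ∈ Submodule.span 𝕜 (Set.range fun l => w (s l)) :=
    Submodule.span_mono (Set.image_subset_range _ _) hiF
  obtain ⟨c, hc⟩ := (Submodule.mem_span_range_iff_exists_fun 𝕜).1 hiR
  have hc0 : ∀ j : Fin k, (j : ℕ) < m → c j = 0 := by
    intro j hj
    have h0 := hi j hj
    rw [← hc, map_sum, Finset.sum_eq_single j] at h0
    · rw [map_smul, smul_eq_mul] at h0
      exact (mul_eq_zero.1 h0).resolve_right ((hq j j).2 rfl)
    · intro l _ hlj
      rw [map_smul, not_not.1 (mt (hq l j).1 hlj), smul_zero]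
    · simp
  rw [← hc]
  refine Submodule.sum_mem _ fun l _ => ?_
  by_cases hl : (l : ℕ) < m
  · rw [hc0 l hl, zero_smul]
    exact Submodule.zero_mem _
  · refine Submodule.smul_mem _ _ (Submodule.subset_span ?_)
    exact ⟨l, not_lt.1 hl, rfl⟩

open Polynomial

/-- The curve `∑ Xʲ qⱼ` in the dual space. -/
noncomputable def dualCurve {k : ℕ} (q : Fin k → ((Fin r → 𝕜) →ₗ[𝕜] 𝕜)) :
    (Fin r → 𝕜) →ₗ[𝕜] 𝕜[X] :=
  ∑ j : Fin k, (Polynomial.monomial (j : ℕ)) ∘ₗ q j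

theorem coeff_dualCurve {k : ℕ} (q : Fin k → ((Fin r → 𝕜) →ₗ[𝕜] 𝕜)) (x : Fin r → 𝕜)
    (j : Fin k) : (dualCurve q x).coeff j = q j x := by
  simp [dualCurve, Polynomial.coeff_monomial, Fin.val_inj]

theorem coeff_dualCurve_of_le {k : ℕ} (q : Fin k → ((Fin r → 𝕜) →ₗ[𝕜] 𝕜)) (x : Fin r → 𝕜)
    {j : ℕ} (hj : k ≤ j) : (dualCurve q x).coeff j = 0 := by
  rw [dualCurve, LinearMap.sum_apply, Polynomial.finsetSum_coeff]
  refine Finset.sum_eq_zero fun l _ => ?_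
  rw [LinearMap.comp_apply, Polynomial.coeff_monomial, if_neg]
  have := l.2
  omega

/-- The linear forms at which the hook tensors are evaluated, by rows of the hook: the curve
`∑ Xʲ qⱼ` in the row `0`, and the constant `qⱼ` in the row `j ≥ 1`. -/
noncomputable def flagForms {k : ℕ} (q : Fin k → ((Fin r → 𝕜) →ₗ[𝕜] 𝕜)) (j : ℕ) :
    (Fin r → 𝕜) →ₗ[𝕜] 𝕜[X] :=
  if j = 0 then dualCurve q else if h : j < k then Polynomial.monomial 0 ∘ₗ q ⟨j, h⟩ else 0

theorem pairing_flagForms_hookTensor {k : ℕ} (hk : 1 ≤ k) (hkn : k ≤ n)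
    (q : Fin k → ((Fin r → 𝕜) →ₗ[𝕜] 𝕜))
    (w : Fin n → (Fin r → 𝕜)) (τ : Equiv.Perm (Fin n)) :
    pairing (fun i : Fin n => flagForms q (hookRow k i)) (hookTensor k w τ) =
      (hookRowPerms n k).card •
        ((∏ i ∈ Finset.univ.filter (fun i => ¬ (τ i : ℕ) < k), dualCurve q (w i)) *
          C (Matrix.of fun i j : {i : Fin n // (i : ℕ) < k} =>
            q ⟨i, i.2⟩ (w (τ.symm j))).det) := by
  rw [hookTensor, pairing_rowSymmetrizer, pairing_antisymmetrizer]
  congr 2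
  · refine Finset.prod_equiv τ.symm (by simp) fun i hi => ?_
    rw [hookRow, if_neg (Finset.mem_filter.1 hi).2, flagForms, if_pos rfl]
  · let z : {i : Fin n // (i : ℕ) < k} := ⟨⟨0, by omega⟩, hk⟩
    let A : Matrix {i : Fin n // (i : ℕ) < k} {i : Fin n // (i : ℕ) < k} 𝕜[X] :=
      Matrix.of fun i j => C (q ⟨i, i.2⟩ (w (τ.symm j)))
    -- The row of the curve is a combination of the rows of the forms `qⱼ`, where `q₀` has
    -- coefficient `1`.
    have hA : (Matrix.of fun i j : {i : Fin n // (i : ℕ) < k} =>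
        flagForms q (hookRow k i) (w (τ.symm j))) =
          A.updateRow z (∑ i : {i : Fin n // (i : ℕ) < k}, (X ^ (i : ℕ) : 𝕜[X]) • A i) := by
      ext1 i j
      rw [Matrix.updateRow_apply, Matrix.of_apply, hookRow, if_pos i.2, flagForms]
      by_cases h1 : ((i : Fin n) : ℕ) = 0
      · rw [if_pos h1, if_pos (Subtype.ext (Fin.ext h1)), dualCurve, LinearMap.sum_apply,
          Finset.sum_apply]
        let e : {i : Fin n // (i : ℕ) < k} ≃ Fin k :=
          { toFun := fun i => ⟨i, i.2⟩
            invFun := fun i => ⟨Fin.castLE hkn i, i.2⟩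
            left_inv := fun _ => rfl
            right_inv := fun _ => rfl }
        refine (Fintype.sum_equiv e _ _ fun i => ?_).symm
        rw [LinearMap.comp_apply, ← Polynomial.C_mul_X_pow_eq_monomial, mul_comm]
        rfl
      · rw [if_neg h1, if_neg (fun h => h1 (by rw [h])), dif_pos i.2]
        rfl
    rw [hA, Matrix.det_updateRow_sum, RingHom.map_det]
    simp only [z, pow_zero, one_smul]
    rfl

/-- For every nbc basis there is a linear form that is nonzero on its hook tensor and zero on the
hook tensors of the other nbc bases: the lowest coefficient along a curve that degenerates along
the flag of spans of the final segments of the basis. -/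
theorem exists_form_of_isNBC [CharZero 𝕜] (v : Matrix (Fin r) (Fin n) 𝕜) {k : ℕ} (hk : 1 ≤ k)
    (hkn : k ≤ n) {S : Set (Fin n)} (hS : (truncation (vectorMatroid v) k).Indep S)
    (hSnbc : IsNBC (truncation (vectorMatroid v) k) S) (hScard : S.encard = k) :
    ∃ f : (⨂[𝕜] _ : Fin n, (Fin r → 𝕜)) →ₗ[𝕜] 𝕜, ∀ τ : Equiv.Perm (Fin n),
      (firstColumn k τ = S → f (hookTensor k (fun i => v.col i) τ) ≠ 0) ∧
      (firstColumn k τ ≠ S → (truncation (vectorMatroid v) k).Indep (firstColumn k τ) →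
        IsNBC (truncation (vectorMatroid v) k) (firstColumn k τ) →
        f (hookTensor k (fun i => v.col i) τ) = 0) := by
  classical
  set w : Fin n → (Fin r → 𝕜) := fun i => v.col i
  set M := truncation (vectorMatroid v) k
  have hME : M.E = Set.univ := rfl
  have hcardS : S.toFinset.card = k := by
    rw [← Set.coe_toFinset S, Set.encard_coe_eq_coe_finsetCard] at hScard
    exact_mod_cast hScard
  let s : Fin k ↪o Fin n := S.toFinset.orderEmbOfFin hcardS
  have hrange : Set.range s = S := by simp [s]
  have hsind : LinearIndependent 𝕜 fun l => w (s l) := by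
    have h1 : LinearIndepOn 𝕜 w (Set.range s) := by rw [hrange]; exact hS.1
    exact (linearIndepOn_range_iff s.injective w).1 h1
  obtain ⟨q, hq, hqspan⟩ := exists_dual_flag w s hsind
  -- The nbc set `S` excludes zero vectors, as their broken circuit is empty.
  have hPne : ∀ i, dualCurve q (w i) ≠ 0 := by
    intro i h0
    have hi0 := hqspan k i hk le_rfl fun j _ => by rw [← coeff_dualCurve, h0, coeff_zero]
    have hwi : w i = 0 := by
      have hempty : {l : Fin k | k ≤ (l : ℕ)} = ∅ :=
        Set.eq_empty_of_forall_notMem fun l h => not_le.2 l.2 h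
      simpa [hempty] using hi0
    have hins := hSnbc.indep_insert hS (Set.empty_subset S) (i := i) (by rw [hME]; trivial)
      (by simp)
    exact hins.1.ne_zero (Set.mem_insert _ _) hwi
  let d : Fin n → ℕ := fun i => (dualCurve q (w i)).natTrailingDegree
  have hdcoeff : ∀ i, (dualCurve q (w i)).coeff (d i) ≠ 0 := fun i =>
    Polynomial.trailingCoeff_nonzero_iff_nonzero.2 (hPne i)
  have hdk : ∀ i, d i < k := fun i => by
    by_contra hle
    exact hdcoeff i (coeff_dualCurve_of_le q _ (not_lt.1 hle))
  have hdlow : ∀ i (j : Fin k), (j : ℕ) < d i → q j (w i) = 0 := fun i j hj => by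
    rw [← coeff_dualCurve]
    exact Polynomial.coeff_eq_zero_of_lt_natTrailingDegree hj
  have hds : ∀ l, d (s l) = l := by
    intro l
    have := hdcoeff (s l)
    rw [← Fin.val_mk (hdk (s l)), coeff_dualCurve, hq] at this
    exact (congrArg Fin.val this).symm
  have hrank : ∀ (m : ℕ) (A : Finset (Fin n)), M.Indep (A : Set (Fin n)) →
      (∀ i ∈ A, m ≤ d i) → A.card ≤ k - m := by
    intro m A hA hAm
    rcases Nat.eq_zero_or_pos m with rfl | hm
    · have := hA.2
      rw [Set.encard_coe_eq_coe_finsetCard] at this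
      exact_mod_cast this
    rcases A.eq_empty_or_nonempty with rfl | ⟨i₀, hi₀⟩
    · simp
    have hmk : m ≤ k := (hAm i₀ hi₀).trans (hdk i₀).le
    have hA1 : LinearIndependent 𝕜 fun i : A => w i := hA.1
    have h1 := finrank_span_eq_card hA1
    rw [Fintype.card_coe] at h1
    have h2 : (fun l => w (s l)) '' {l : Fin k | m ≤ (l : ℕ)} =
        ((Finset.univ.filter fun l : Fin k => m ≤ (l : ℕ)).image fun l => w (s l) :
          Finset (Fin r → 𝕜)) := by simp
    rw [← h1, ← card_filter_le_fin]
    refine le_trans (Submodule.finrank_mono (Submodule.span_le.2 ?_))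
      ((finrank_span_finset_le_card _).trans
        (Finset.card_image_le (s := Finset.univ.filter fun l : Fin k => m ≤ (l : ℕ))
          (f := fun l => w (s l))))
    rintro _ ⟨i, rfl⟩
    rw [← h2]
    exact hqspan m i hm hmk fun j hj => hdlow i j (hj.trans_le (hAm i i.2))
  choose Q hQ using fun i => (Polynomial.X_pow_dvd_iff (f := dualCurve q (w i)) (n := d i)).2
    fun j hj => Polynomial.coeff_eq_zero_of_lt_natTrailingDegree hj
  have hQ0 : ∀ i, (Q i).eval 0 ≠ 0 := by
    intro i h0
    refine hdcoeff i ?_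
    rw [hQ i, Polynomial.coeff_X_pow_mul', if_pos le_rfl, Nat.sub_self,
      Polynomial.coeff_zero_eq_eval_zero, h0]
  have hprod : ∀ τ : Equiv.Perm (Fin n),
      ∏ i ∈ Finset.univ.filter (fun i => ¬ (τ i : ℕ) < k), dualCurve q (w i) =
        X ^ (∑ i ∈ Finset.univ.filter (fun i => ¬ (τ i : ℕ) < k), d i) *
          ∏ i ∈ Finset.univ.filter (fun i => ¬ (τ i : ℕ) < k), Q i := by
    intro τ
    rw [← Finset.prod_pow_eq_pow_sum, ← Finset.prod_mul_distrib]
    exact Finset.prod_congr rfl fun i _ => hQ i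
  have hcompl : ∀ τ : Equiv.Perm (Fin n),
      ∑ i ∈ Finset.univ.filter (fun i => (τ i : ℕ) < k), d i +
        ∑ i ∈ Finset.univ.filter (fun i => ¬ (τ i : ℕ) < k), d i = ∑ i, d i := fun τ =>
    Finset.sum_filter_add_sum_filter_not _ _ _
  have hcoe : ∀ τ : Equiv.Perm (Fin n),
      ((Finset.univ.filter (fun i => (τ i : ℕ) < k) : Finset (Fin n)) : Set (Fin n)) =
        firstColumn k τ := fun τ => by ext i; simp [mem_firstColumn]
  let N : ℕ := ∑ i, d i - ∑ l : Fin k, (l : ℕ)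
  refine ⟨Polynomial.lcoeff 𝕜 N ∘ₗ pairing fun i : Fin n => flagForms q (hookRow k i),
    fun τ => ⟨fun hτ => ?_, fun hτ hind hnbc => ?_⟩⟩
  · have hsum : ∑ i ∈ Finset.univ.filter (fun i => (τ i : ℕ) < k), d i =
        ∑ l : Fin k, (l : ℕ) := by
      have : Finset.univ.filter (fun i => (τ i : ℕ) < k) = Finset.univ.image s := by
        apply Finset.coe_injective
        rw [hcoe, hτ, Finset.coe_image, Finset.coe_univ, Set.image_univ, hrange]
      rw [this, Finset.sum_image s.injective.injOn]
      exact Finset.sum_congr rfl fun l _ => hds l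
    have hN : ∑ i ∈ Finset.univ.filter (fun i => ¬ (τ i : ℕ) < k), d i = N := by
      have := hcompl τ
      omega
    have hdet : (Matrix.of fun i j : {i : Fin n // (i : ℕ) < k} =>
        q ⟨i, i.2⟩ (w (τ.symm j))).det ≠ 0 := by
      rw [ne_eq, ← Matrix.exists_mulVec_eq_zero_iff]
      rintro ⟨a, ha, ha0⟩
      refine ha (funext fun j => ?_)
      have hj : τ.symm j ∈ Set.range s := by
        rw [hrange, ← hτ, mem_firstColumn, Equiv.apply_symm_apply]
        exact j.2
      obtain ⟨l, hl⟩ := hj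
      have h0 := congrFun ha0 ⟨Fin.castLE hkn l, l.2⟩
      rw [Matrix.mulVec, dotProduct, Finset.sum_eq_single j] at h0
      · refine (mul_eq_zero.1 h0).resolve_left ?_
        rw [Matrix.of_apply, ← hl]
        exact (hq l l).2 rfl
      · intro j' _ hj'
        have : τ.symm j' ∈ Set.range s := by
          rw [hrange, ← hτ, mem_firstColumn, Equiv.apply_symm_apply]
          exact j'.2
        obtain ⟨l', hl'⟩ := this
        have hne : l' ≠ l := by
          rintro rfl
          exact hj' (Subtype.ext (τ.symm.injective (hl'.symm.trans hl)))
        have hzero : q l (w (s l')) = 0 := not_not.1 (mt (hq l' l).1 hne)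
        rw [Matrix.of_apply, ← hl']
        exact mul_eq_zero_of_left hzero _
      · simp
    rw [LinearMap.comp_apply, pairing_flagForms_hookTensor hk hkn, hprod, hN, map_nsmul,
      Polynomial.lcoeff_apply, Polynomial.coeff_mul_C, Polynomial.coeff_X_pow_mul',
      if_pos le_rfl, Nat.sub_self, Polynomial.coeff_zero_eq_eval_zero, Polynomial.eval_prod]
    refine smul_ne_zero ?_ (mul_ne_zero (Finset.prod_ne_zero_iff.2 fun i _ => hQ0 i) hdet)
    refine Finset.card_ne_zero_of_mem (a := 1) ?_
    rw [mem_hookRowPerms]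
    exact fun _ => rfl
  · have hlt := sum_lt_sum_of_isNBC hME hdk hrank s.strictMono hds (hrange ▸ hS)
      (hrange ▸ hSnbc) (B := Finset.univ.filter (fun i => (τ i : ℕ) < k))
      (by rw [hcoe]; exact hind) (by rw [hcoe]; exact hnbc)
      (by
        have := encard_firstColumn hkn τ
        rw [← hcoe, Set.encard_coe_eq_coe_finsetCard] at this
        exact_mod_cast this)
      (by rw [hcoe, hrange]; exact hτ)
    have hN : N < ∑ i ∈ Finset.univ.filter (fun i => ¬ (τ i : ℕ) < k), d i := by
      have h1 := hcompl τ
      have h2 : ∑ l : Fin k, (l : ℕ) ≤ ∑ i, d i := by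
        calc ∑ l : Fin k, (l : ℕ) = ∑ i ∈ Finset.univ.image s, d i := by
              rw [Finset.sum_image s.injective.injOn]
              exact Finset.sum_congr rfl fun l _ => (hds l).symm
          _ ≤ ∑ i, d i := Finset.sum_le_sum_of_subset (Finset.subset_univ _)
      omega
    rw [LinearMap.comp_apply, pairing_flagForms_hookTensor hk hkn, hprod, map_nsmul,
      Polynomial.lcoeff_apply, Polynomial.coeff_mul_C, Polynomial.coeff_X_pow_mul',
      if_neg (not_le.2 hN), zero_mul, smul_zero]

end Degeneration

/-! ### The dimension of the span of the hook tensors -/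

section Dimension

variable {𝕜 : Type*} [Field 𝕜] {r n : ℕ}

/-- If `k` is at most the rank, the hook tensors span a space whose dimension is the number of nbc
bases of the truncation. -/
theorem finrank_span_hookTensor [CharZero 𝕜] (v : Matrix (Fin r) (Fin n) 𝕜) {k : ℕ} (hk : 1 ≤ k)
    (hkn : k ≤ n) (hrank : (k : ℕ∞) ≤ (vectorMatroid v).eRank) :
    Module.finrank 𝕜 (Submodule.span 𝕜 (Set.range (hookTensor k fun i => v.col i))) =
      numNBCBases (truncation (vectorMatroid v) k) := by
  classical
  set M := truncation (vectorMatroid v) k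
  have hcard : ∀ S, M.IsBase S → S.encard = k := by
    intro S hS
    obtain ⟨B, hB⟩ := (vectorMatroid v).exists_isBase
    rw [← hB.encard_eq_eRank] at hrank
    obtain ⟨I, hIB, hI⟩ := Set.exists_subset_encard_eq hrank
    rw [hS.encard_eq_encard_of_isBase (isBase_truncation (hB.indep.subset hIB) hI), hI]
  let ι := {S : Set (Fin n) | M.IsBase S ∧ IsNBC M S}
  choose τ hτ using fun S : ι => exists_firstColumn_eq hkn (hcard S S.2.1)
  let x : ι → ⨂[𝕜] _ : Fin n, (Fin r → 𝕜) := fun S => hookTensor k (fun i => v.col i) (τ S)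
  have hspan : Submodule.span 𝕜 (Set.range (hookTensor k fun i => v.col i)) =
      Submodule.span 𝕜 (Set.range x) := by
    refine le_antisymm (Submodule.span_le.2 ?_) (Submodule.span_mono ?_)
    · rintro _ ⟨σ, rfl⟩
      refine Submodule.span_le.2 ?_ (hookTensor_mem_span_nbc v hk hkn σ)
      rintro _ ⟨ρ, hbase, hnbc, rfl⟩
      have hmem := hookTensor_mem_span_of_forall_lt_iff (k := k) (fun i => v.col i) (σ := ρ)
        (τ := τ ⟨_, hbase, hnbc⟩) fun i => (Set.ext_iff.1 (hτ ⟨_, hbase, hnbc⟩).symm i)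
      exact Submodule.span_mono
        (Set.singleton_subset_iff.2 (Set.mem_range_self (⟨_, hbase, hnbc⟩ : ι))) hmem
    · rintro _ ⟨S, rfl⟩
      exact ⟨_, rfl⟩
  have hli : LinearIndependent 𝕜 x := by
    rw [linearIndependent_iff']
    intro s c hc S hS
    obtain ⟨f, hf⟩ := exists_form_of_isNBC v hk hkn S.2.1.indep S.2.2 (hcard S S.2.1)
    have h0 := congrArg f hc
    rw [map_sum, map_zero, Finset.sum_eq_single S, map_smul, smul_eq_mul] at h0
    · exact (mul_eq_zero.1 h0).resolve_right ((hf _).1 (hτ S))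
    · intro S' _ hne
      rw [map_smul, (hf (τ S')).2, smul_zero]
      · rw [hτ]
        exact fun h => hne (Subtype.ext h)
      · rw [hτ]
        exact S'.2.1.indep
      · rw [hτ]
        exact S'.2.2
    · exact fun h => absurd hS h
  have hfin : Fintype ι := Fintype.ofFinite ι
  rw [hspan, finrank_span_eq_card hli, ← Nat.card_eq_fintype_card, Nat.card_coe_set_eq]
  rfl

theorem finrank_span_hookTensor_eq_zero (v : Matrix (Fin r) (Fin n) 𝕜) {k : ℕ}
    (hkn : k ≤ n) (hrank : ¬ (k : ℕ∞) ≤ (vectorMatroid v).eRank) :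
    Module.finrank 𝕜 (Submodule.span 𝕜 (Set.range (hookTensor k fun i => v.col i))) = 0 := by
  have : Submodule.span 𝕜 (Set.range (hookTensor k fun i => v.col i)) = ⊥ := by
    rw [Submodule.span_eq_bot]
    rintro _ ⟨σ, rfl⟩
    refine hookTensor_eq_zero fun hind => hrank ?_
    rw [← encard_firstColumn hkn σ]
    exact hind.encard_le_eRank
  rw [this, finrank_bot]

end Dimension

/-! ### The multiplicity as a dimension -/

section Multiplicity

/-- By Maschke's theorem, equivariant maps from the left ideal generated by `c` extend to the group
algebra, so that they are determined by the image of `c`, which ranges over `c • W`. -/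
theorem finrank_hom_span_singleton {𝕜 G W : Type*} [Field 𝕜] [Group G] [Finite G]
    [NeZero (Nat.card G : 𝕜)] [AddCommMonoid W] [Module 𝕜 W] [Module (MonoidAlgebra 𝕜 G) W]
    [IsScalarTower 𝕜 (MonoidAlgebra 𝕜 G) W] (c : MonoidAlgebra 𝕜 G) :
    Module.finrank 𝕜 (Submodule.span (MonoidAlgebra 𝕜 G) {c} →ₗ[MonoidAlgebra 𝕜 G] W) =
      Module.finrank 𝕜 (LinearMap.range (Algebra.lsmul 𝕜 𝕜 W c)) := by
  let I := Submodule.span (MonoidAlgebra 𝕜 G) {c}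
  let c' : I := ⟨c, Submodule.mem_span_singleton_self c⟩
  let ev : (I →ₗ[MonoidAlgebra 𝕜 G] W) →ₗ[𝕜] W :=
    { toFun := fun φ => φ c'
      map_add' := fun _ _ => rfl
      map_smul' := fun _ _ => rfl }
  have hinj : Function.Injective ev := by
    intro φ ψ h
    refine LinearMap.ext fun y => ?_
    obtain ⟨y, hy⟩ := y
    obtain ⟨a, rfl⟩ := Submodule.mem_span_singleton.1 hy
    have : (⟨a • c, hy⟩ : I) = a • c' := rfl
    rw [this, map_smul, map_smul]
    exact congrArg (a • ·) h
  have hrange : LinearMap.range ev = LinearMap.range (Algebra.lsmul 𝕜 𝕜 W c) := by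
    ext x
    constructor
    · rintro ⟨φ, rfl⟩
      obtain ⟨g, hg⟩ := MonoidAlgebra.exists_leftInverse_of_injective I.subtype I.ker_subtype
      refine ⟨φ (g 1), ?_⟩
      change c • φ (g 1) = φ c'
      rw [← map_smul, ← map_smul, smul_eq_mul, mul_one]
      exact congrArg φ (LinearMap.congr_fun hg c')
    · rintro ⟨x, rfl⟩
      exact ⟨(LinearMap.toSpanSingleton (MonoidAlgebra 𝕜 G) W x) ∘ₗ I.subtype, rfl⟩
  rw [← hrange, LinearMap.finrank_range_of_inj hinj]

variable {𝕜 : Type*} [Field 𝕜] {r n : ℕ}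

theorem asAlgebraHom_youngSymmetrizer {k : ℕ} (hk : 1 ≤ k) (hkn : k ≤ n) :
    (permTensor 𝕜 r n).asAlgebraHom (youngSymmetrizer 𝕜 (hookFilling hk hkn)) =
      rowSymmetrizer 𝕜 r n k * antisymmetrizer 𝕜 r n k := by
  have hval : ∀ i : Fin n, (hookFilling hk hkn i).1 =
      if (i : ℕ) < k then ((i : ℕ), 0) else (0, (i : ℕ) - k + 1) := fun _ => rfl
  have hrow : ∀ i : Fin n, (hookFilling hk hkn i).1.1 = hookRow k i := by
    intro i
    rw [hval, hookRow]
    split_ifs <;> rfl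
  have hcol : ∀ q : Equiv.Perm (Fin n), (∀ i, (hookFilling hk hkn (q i)).1.2 =
      (hookFilling hk hkn i).1.2) ↔ q ∈ firstPerms n k := by
    intro q
    have hcol' : ∀ i : Fin n, (hookFilling hk hkn i).1.2 =
        if (i : ℕ) < k then 0 else (i : ℕ) - k + 1 := by
      intro i
      rw [hval]
      split_ifs <;> rfl
    simp only [hcol']
    constructor
    · intro h
      rw [mem_firstPerms]
      intro i hi
      have := h i
      rw [if_neg (not_lt.2 hi)] at this
      apply Fin.ext
      split_ifs at this
      omega
    · intro h i
      by_cases hi : (i : ℕ) < k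
      · rw [if_pos hi, if_pos (lt_of_mem_firstPerms h hi)]
      · rw [mem_firstPerms.1 h i (not_lt.1 hi)]
  rw [youngSymmetrizer, map_mul, map_sum, map_sum, rowSymmetrizer, antisymmetrizer]
  congr 1
  · refine Finset.sum_congr ?_ fun p _ => Representation.asAlgebraHom_of _ _
    ext p
    simp [mem_hookRowPerms, hrow]
  · refine Finset.sum_congr ?_ fun p _ => ?_
    · ext q
      simp [hcol]
    · rw [map_zsmul, Representation.asAlgebraHom_of, ← Int.cast_smul_eq_zsmul 𝕜]

/-- The multiplicity of the hook is the dimension of the space spanned by the images of the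
permutations of `v₁ ⊗ ⋯ ⊗ vₙ` under the Young symmetrizer. -/
theorem spechtMultiplicity_hook [CharZero 𝕜] (v : Matrix (Fin r) (Fin n) 𝕜) {k : ℕ} (hk : 1 ≤ k)
    (hkn : k ≤ n) :
    spechtMultiplicity 𝕜 (hookFilling hk hkn) (cyclicModule v) =
      Module.finrank 𝕜 (Submodule.span 𝕜 (Set.range (hookTensor k fun i => v.col i))) := by
  set c := youngSymmetrizer 𝕜 (hookFilling hk hkn)
  set ρ := permTensor 𝕜 r n
  set t := PiTensorProduct.tprod 𝕜 fun i => v.col i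
  have hne : NeZero (Nat.card (Equiv.Perm (Fin n)) : 𝕜) :=
    ⟨Nat.cast_ne_zero.2 Nat.card_pos.ne'⟩
  rw [spechtMultiplicity, spechtModule, finrank_hom_span_singleton]
  let ψ : cyclicModule v →ₗ[𝕜] ⨂[𝕜] _ : Fin n, (Fin r → 𝕜) :=
    ρ.asModuleEquiv.toLinearMap ∘ₗ (cyclicModule v).subtype.restrictScalars 𝕜
  have hψ : Function.Injective ψ := ρ.asModuleEquiv.injective.comp Subtype.val_injective
  have hψc : ∀ (a : MonoidAlgebra 𝕜 (Equiv.Perm (Fin n))) (y : cyclicModule v),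
      ψ (a • y) = ρ.asAlgebraHom a (ψ y) := fun a y => ρ.asModuleEquiv_map_smul a y
  have hcρ : ρ.asAlgebraHom c = rowSymmetrizer 𝕜 r n k * antisymmetrizer 𝕜 r n k :=
    asAlgebraHom_youngSymmetrizer hk hkn
  let t' : cyclicModule v := ⟨_, Submodule.mem_span_singleton_self _⟩
  have ht' : ψ t' = t := ρ.asModuleEquiv.apply_symm_apply t
  have hmap : (LinearMap.range (Algebra.lsmul 𝕜 𝕜 (cyclicModule v) c)).map ψ =
      Submodule.span 𝕜 (Set.range (hookTensor k fun i => v.col i)) := by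
    apply le_antisymm
    · rintro _ ⟨_, ⟨⟨y, hy⟩, rfl⟩, rfl⟩
      obtain ⟨a, rfl⟩ := Submodule.mem_span_singleton.1 hy
      have hy' : (⟨_, hy⟩ : cyclicModule v) = a • t' := rfl
      rw [hy', Algebra.lsmul_apply, hψc, hψc, ht', hcρ]
      clear hy' hy
      induction a using MonoidAlgebra.induction_on with
      | of σ =>
        rw [Representation.asAlgebraHom_of]
        exact Submodule.subset_span ⟨σ, rfl⟩
      | add a b ha hb =>
        rw [map_add, LinearMap.add_apply, map_add]
        exact Submodule.add_mem _ ha hb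
      | smul x a ha =>
        rw [map_smul, LinearMap.smul_apply, map_smul]
        exact Submodule.smul_mem _ _ ha
    · rw [Submodule.span_le]
      rintro _ ⟨σ, rfl⟩
      refine ⟨_, ⟨MonoidAlgebra.of 𝕜 _ σ • t', rfl⟩, ?_⟩
      rw [Algebra.lsmul_apply, hψc, hψc, ht', hcρ, Representation.asAlgebraHom_of]
      rfl
  rw [← hmap]
  exact (Submodule.equivMapOfInjective ψ hψ _).finrank_eq

end Multiplicity

end TensorModule

theorem theorem7p12 {𝕜 : Type*} [Field 𝕜] [CharZero 𝕜] {r n : ℕ}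
    (v : Matrix (Fin r) (Fin n) 𝕜) (k : ℕ) (hk : 1 ≤ k) (hkn : k ≤ n) :
    ((k : ℕ∞) ≤ (TensorModule.vectorMatroid v).eRank →
      TensorModule.spechtMultiplicity 𝕜 (TensorModule.hookFilling hk hkn)
          (TensorModule.cyclicModule v) =
        TensorModule.numNBCBases
          (TensorModule.truncation (TensorModule.vectorMatroid v) k)) ∧
    (¬ (k : ℕ∞) ≤ (TensorModule.vectorMatroid v).eRank →
      TensorModule.spechtMultiplicity 𝕜 (TensorModule.hookFilling hk hkn)
          (TensorModule.cyclicModule v) = 0) := by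
  rw [TensorModule.spechtMultiplicity_hook v hk hkn]
  exact ⟨TensorModule.finrank_span_hookTensor v hk hkn,
    TensorModule.finrank_span_hookTensor_eq_zero v hkn⟩
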